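/- **One-shot device model.** There are $I$ testing conditions with fixed stress vectors $\boldsymbol x_i=(x_{i0},\dots,x_{iJ})\in\mathbb R^{J+1}$ and inspection times $\tau_i>0$. For $\boldsymbol\theta=(a_0,\dots,a_J,b_0,\dots,b_J)\in\mathbb R^{2(J+1)}$ put $\alpha_i=\exp(\sum_j a_jx_{ij})$, $\beta_i=\exp(\sum_j b_jx_{ij})$, $F_i(\boldsymbol\theta)=\tau_i^{\beta_i}/(\tau_i^{\beta_i}+\alpha_i^{\beta_i})$ and $R_i(\boldsymbol\theta)=1-F_i(\boldsymbol\theta)$. All device lifetimes are independent, and under the true parameter $\boldsymbol\theta_0$ a device under condition $i$ has a log-logistic lifetime, with distribution function $t\mapsto t^{\beta_i}/(t^{\beta_i}+\alpha_i^{\beta_i})$, $t>0$. Under condition $i$, $K_i$ devices are tested, $n_i$ is the number of those with lifetime at most $\tau_i$, and $K=K_1+\dots+K_I$. The likelihood is $L(\boldsymbol\theta)=\prod_i F_i(\boldsymbol\theta)^{n_i}R_i(\boldsymbol\theta)^{K_i-n_i}$. Suppose that $K\to\infty$ along a sequence of group sizes with $K_i/K\to w_i$ for every $i$, and let $$\boldsymbol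 I_F(\boldsymbol\theta)=\sum_{i=1}^I w_i\,(R_iF_i)^2\,(F_i^{-1}+R_i^{-1})\,\boldsymbol M_i,\qquad \boldsymbol M_i=\begin{pmatrix}\beta_i^2\boldsymbol x_i\boldsymbol x_i^T&-\log\frac{\tau_i}{\alpha_i}\beta_i^2\boldsymbol x_i\boldsymbol x_i^T\\-\log\frac{\tau_i}{\alpha_i}\beta_i^2\boldsymbol x_i\boldsymbol x_i^T&(\log\frac{\tau_i}{\alpha_i}\beta_i)^2\boldsymbol x_i\boldsymbol x_i^T\end{pmatrix}$$ be the limiting Fisher information matrix per observation. **Restriction.** Let $\boldsymbol m:\mathbb R^{2(J+1)}\to\mathbb R^r$, $\Theta_0=\{\boldsymbol\theta:\boldsymbol m(\boldsymbol\theta)=\boldsymbol 0\}$ and $\boldsymbol M(\boldsymbol\theta)=\partial\boldsymbol m^T(\boldsymbol\theta)/\partial\boldsymbol\theta$, a $2(J+1)\times r$ matrix. Assume that $\boldsymbol\theta_0\in\Theta_0$, that $\boldsymbol m$ is continuously differentiable near $\boldsymbol\theta_0$, that $\operatorname{rank}\boldsymbol M(\boldsymbol\theta_0)=r$, and that $\boldsymbol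 I_F(\boldsymbol\theta_0)$ is invertible. For $\gamma=0$ the restricted estimating equations are: $\boldsymbol m(\boldsymbol\theta)=\boldsymbol 0$ and $\boldsymbol U_0(\boldsymbol\theta)+\boldsymbol M(\boldsymbol\theta)\boldsymbol\lambda=\boldsymbol 0$ for some $\boldsymbol\lambda\in\mathbb R^r$, where $\boldsymbol U_0(\boldsymbol\theta)=\sum_i(K_iF_i-n_i)\,(-\beta_i\boldsymbol x_i,\ \log\tfrac{\tau_i}{\alpha_i}\beta_i\boldsymbol x_i)^T$. Estimators are functions of the counts $(n_1,\dots,n_I)$. **Theorem (restricted MLE, $\gamma=0$).** (a) There is a sequence of estimators, converging in probability to $\boldsymbol\theta_0$, which with probability tending to one solve the restricted estimating equations and are local maximizers of $L$ on $\Theta_0$. (b) Let $\tilde{\boldsymbol\theta}$ be any sequence of estimators converging in probability to $\boldsymbol\theta_0$ such that, with probability tending to one, $\tilde{\boldsymbol\theta}$ solves the restricted estimating equations; or such that, with probability tending to one, $\tilde{\boldsymbol\theta}$ is a restricted MLE, i.e. maximizes $L$ over $\Theta_0$. Then $$\sqrt K(\tilde{\boldsymbol\theta}-\boldsymbol\theta_0)\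 \xrightarrow{\ \mathcal L\ }\ N\bigl(\boldsymbol 0,\boldsymbol S(\boldsymbol\theta_0)\bigr),$$ where $$\boldsymbol S=\boldsymbol I_F^{-1}\Bigl(\boldsymbol I_F-\boldsymbol M\bigl(\boldsymbol M^T\boldsymbol I_F^{-1}\boldsymbol M\bigr)^{-1}\boldsymbol M^T\Bigr)\boldsymbol I_F^{-1}$$ (all matrices at $\boldsymbol\theta_0$) is positive semidefinite. -/

import Mathlib

open MeasureTheory ProbabilityTheory Filter Topology

noncomputable section

namespace OneShot

/-- The parameter space `ℝ^{2(J+1)}` of vectors `θ = (a_0, …, a_J, b_0, …, b_J)`, where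
`a_j = θ (Sum.inl j)` and `b_j = θ (Sum.inr j)`. -/
abbrev Param (J : ℕ) : Type := EuclideanSpace ℝ (Fin (J + 1) ⊕ Fin (J + 1))

/-- The fixed experimental conditions: `I` testing conditions, with stress vectors
`x i = (x_{i0}, …, x_{iJ})` and inspection times `τ i > 0`. -/
structure Design (I J : ℕ) where
  x : Fin I → Fin (J + 1) → ℝ
  τ : Fin I → ℝ
  τ_pos : ∀ i, 0 < τ i

/-- The log-logistic distribution function with scale `α` and shape `β` (it vanishes for
`t ≤ 0`). -/
def logLogisticCDF (α β t : ℝ) : ℝ :=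
  if 0 < t then t ^ β / (t ^ β + α ^ β) else 0

/-- `T` has the log-logistic distribution with scale `α` and shape `β`, i.e. it has the
distribution function above. -/
def IsLogLogistic {Ω : Type*} [MeasurableSpace Ω] (P : Measure Ω) (T : Ω → ℝ) (α β : ℝ) : Prop :=
  ∀ t : ℝ, P.real {ω | T ω ≤ t} = logLogisticCDF α β t

variable {I J r : ℕ}

/-- The scale `α_i = exp (∑_j a_j x_{ij})`. -/
def scale (D : Design I J) (θ : Param J) (i : Fin I) : ℝ :=
  Real.exp (∑ j, θ (Sum.inl j) * D.x i j)

/-- The shape `β_i = exp (∑_j b_j x_{ij})`. -/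
def shape (D : Design I J) (θ : Param J) (i : Fin I) : ℝ :=
  Real.exp (∑ j, θ (Sum.inr j) * D.x i j)

/-- The probability of failure `F_{α_i, β_i}(τ_i)` before the inspection time. -/
def failProb (D : Design I J) (θ : Param J) (i : Fin I) : ℝ :=
  logLogisticCDF (scale D θ i) (shape D θ i) (D.τ i)

/-- The reliability `R_{α_i, β_i}(τ_i)` at the inspection time. -/
def reliability (D : Design I J) (θ : Param J) (i : Fin I) : ℝ :=
  1 - failProb D θ i

/-- The likelihood of `θ` when `n i` of the `Ks i` devices under condition `i` have failed. -/
def likelihood (D : Design I J) (Ks n : Fin I → ℕ) (θ : Param J) : ℝ :=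
  ∏ i, failProb D θ i ^ n i * reliability D θ i ^ (Ks i - n i)

/-- The estimating function `U_γ(θ)` of the weighted minimum density power divergence
estimator. -/
def estimatingFun (D : Design I J) (Ks n : Fin I → ℕ) (γ : ℝ) (θ : Param J) :
    Fin (J + 1) ⊕ Fin (J + 1) → ℝ :=
  ∑ i,
    (((Ks i : ℝ) *
          (D.τ i ^ shape D θ i / (D.τ i ^ shape D θ i + scale D θ i ^ shape D θ i)) - n i) *
        ((D.τ i ^ (shape D θ i * γ) * scale D θ i ^ shape D θ i
            + scale D θ i ^ (shape D θ i * γ) * D.τ i ^ shape D θ i) /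
          (D.τ i ^ shape D θ i + scale D θ i ^ shape D θ i) ^ (γ + 1))) •
      Sum.elim (fun j => -shape D θ i * D.x i j)
        (fun j => Real.log (D.τ i / scale D θ i) * shape D θ i * D.x i j)

/-- The block matrix `M_i`. -/
def condMatrix (D : Design I J) (θ : Param J) (i : Fin I) :
    Matrix (Fin (J + 1) ⊕ Fin (J + 1)) (Fin (J + 1) ⊕ Fin (J + 1)) ℝ :=
  Matrix.fromBlocks
    (shape D θ i ^ 2 • Matrix.vecMulVec (D.x i) (D.x i))
    ((-Real.log (D.τ i / scale D θ i) * shape D θ i ^ 2) • Matrix.vecMulVec (D.x i) (D.x i))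
    ((-Real.log (D.τ i / scale D θ i) * shape D θ i ^ 2) • Matrix.vecMulVec (D.x i) (D.x i))
    ((Real.log (D.τ i / scale D θ i) * shape D θ i) ^ 2 • Matrix.vecMulVec (D.x i) (D.x i))

/-- The (per-observation) Fisher information matrix, when the proportion of devices under
condition `i` is `w i`. -/
def fisherInfo (D : Design I J) (w : Fin I → ℝ) (θ : Param J) :
    Matrix (Fin (J + 1) ⊕ Fin (J + 1)) (Fin (J + 1) ⊕ Fin (J + 1)) ℝ :=
  ∑ i, (w i * (reliability D θ i * failProb D θ i) ^ 2 *
      ((failProb D θ i)⁻¹ + (reliability D θ i)⁻¹)) • condMatrix D θ i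

/-- The `2(J+1) × r` matrix `M(θ) = ∂ m(θ)ᵀ / ∂ θ`. -/
def constraintMatrix (m : Param J → EuclideanSpace ℝ (Fin r)) (θ : Param J) :
    Matrix (Fin (J + 1) ⊕ Fin (J + 1)) (Fin r) ℝ :=
  Matrix.of fun p s => fderiv ℝ m θ (EuclideanSpace.single p 1) s

/-- The restricted parameter space `Θ_0`. -/
def restrictedSpace (m : Param J → EuclideanSpace ℝ (Fin r)) : Set (Param J) :=
  {θ | m θ = 0}

/-- `θ` is a restricted maximum likelihood estimate: it maximizes the likelihood over `Θ_0`. -/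
def IsRestrictedMLE (D : Design I J) (m : Param J → EuclideanSpace ℝ (Fin r))
    (Ks n : Fin I → ℕ) (θ : Param J) : Prop :=
  θ ∈ restrictedSpace m ∧ IsMaxOn (likelihood D Ks n) (restrictedSpace m) θ

/-- `θ` is a local maximizer over `Θ_0` of the likelihood. -/
def IsRestrictedLocalMLE (D : Design I J) (m : Param J → EuclideanSpace ℝ (Fin r))
    (Ks n : Fin I → ℕ) (θ : Param J) : Prop :=
  θ ∈ restrictedSpace m ∧ IsLocalMaxOn (likelihood D Ks n) (restrictedSpace m) θ

/-- `θ` solves the restricted estimating equations with tuning parameter `γ`: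
`U_γ(θ) + M(θ) λ = 0` for some vector `λ` of Lagrange multipliers, and `m(θ) = 0`. -/
def IsRestrictedRoot (D : Design I J) (m : Param J → EuclideanSpace ℝ (Fin r))
    (Ks n : Fin I → ℕ) (γ : ℝ) (θ : Param J) : Prop :=
  (∃ lam : Fin r → ℝ,
    estimatingFun D Ks n γ θ + (constraintMatrix m θ).mulVec lam = 0) ∧ m θ = 0

/-- The asymptotic covariance matrix
`S = I_F⁻¹ (I_F - M (Mᵀ I_F⁻¹ M)⁻¹ Mᵀ) I_F⁻¹` of the restricted estimator. -/
def asympCov (D : Design I J) (m : Param J → EuclideanSpace ℝ (Fin r)) (w : Fin I → ℝ)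
    (θ : Param J) : Matrix (Fin (J + 1) ⊕ Fin (J + 1)) (Fin (J + 1) ⊕ Fin (J + 1)) ℝ :=
  (fisherInfo D w θ)⁻¹ *
    (fisherInfo D w θ -
      constraintMatrix m θ *
        ((constraintMatrix m θ).transpose * (fisherInfo D w θ)⁻¹ * constraintMatrix m θ)⁻¹ *
        (constraintMatrix m θ).transpose) *
    (fisherInfo D w θ)⁻¹

/-- The number of failures under each condition: among the first `Ks i` devices put under
condition `i`, with lifetimes `T i 0, T i 1, …`, those with lifetime at most `τ i`. -/
def failures {Ω : Type*} (D : Design I J) (T : Fin I → ℕ → Ω → ℝ) (Ks : Fin I → ℕ) (ω : Ω) :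
    Fin I → ℕ :=
  fun i => ((Finset.range (Ks i)).filter fun k => T i k ω ≤ D.τ i).card

/-- The total number `K` of devices. -/
def total (Ks : Fin I → ℕ) : ℕ := ∑ i, Ks i

end OneShot

end

noncomputable section

/-! ### The normalised log-likelihood of a binomial model with logits `η i θ` -/

namespace BinomialLogit

open Real Asymptotics

variable {ι E F : Type*} [Fintype ι] [NormedAddCommGroup E] [NormedSpace ℝ E]
  [NormedAddCommGroup F] [NormedSpace ℝ F]

/-- The log-likelihood with (possibly fractional) group sizes `k` and failure counts `p`. -/
def logLik (η : ι → E → ℝ) (k p : ι → ℝ) (θ : E) : ℝ :=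
  ∑ i, (p i * η i θ - k i * log (1 + exp (η i θ)))

/-- The derivative of the log-likelihood. -/
def score (η : ι → E → ℝ) (k p : ι → ℝ) (θ : E) : E →L[ℝ] ℝ :=
  ∑ i, (p i - k i * sigmoid (η i θ)) • fderiv ℝ (η i) θ

/-- The information form with weights `w`. -/
def info (η : ι → E → ℝ) (w : ι → ℝ) (θ : E) : E →L[ℝ] E →L[ℝ] ℝ :=
  ∑ i, (w i * (sigmoid (η i θ) * (1 - sigmoid (η i θ)))) •
    (fderiv ℝ (η i) θ).smulRight (fderiv ℝ (η i) θ)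

/-- The expected failure proportions. -/
def meanProp (η : ι → E → ℝ) (w : ι → ℝ) (θ : E) : ι → ℝ := fun i => w i * sigmoid (η i θ)

lemma exp_div_one_add_exp (x : ℝ) : exp x / (1 + exp x) = sigmoid x := by
  rw [sigmoid_def, exp_neg]
  have := exp_pos x
  field_simp
  ring

lemma hasStrictFDerivAt_logLik {η : ι → E → ℝ} (hη : ∀ i, ContDiff ℝ 2 (η i)) (k p : ι → ℝ)
    (θ : E) : HasStrictFDerivAt (logLik η k p) (score η k p θ) θ := by
  have h : ∀ i ∈ Finset.univ, HasStrictFDerivAt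
      (fun θ => p i * η i θ - k i * log (1 + exp (η i θ)))
      ((p i - k i * sigmoid (η i θ)) • fderiv ℝ (η i) θ) θ := by
    intro i _
    have h1 : HasStrictFDerivAt (η i) (fderiv ℝ (η i) θ) θ :=
      (hη i).contDiffAt.hasStrictFDerivAt (by norm_num)
    have h2 : HasStrictDerivAt (fun y => log (1 + exp y)) (sigmoid (η i θ)) (η i θ) := by
      have := ((Real.hasStrictDerivAt_exp (η i θ)).const_add 1).log
        (by positivity : (1 + exp (η i θ)) ≠ 0)
      rwa [exp_div_one_add_exp] at this
    rw [sub_smul, mul_smul]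
    exact (h1.const_mul (p i)).sub ((h2.comp_hasStrictFDerivAt θ h1).const_mul (k i))
  exact HasStrictFDerivAt.fun_sum h

lemma mul_sub_lt_log_one_add_exp_sub {x y : ℝ} (h : y ≠ x) :
    sigmoid x * (y - x) < log (1 + exp y) - log (1 + exp x) := by
  have hx := exp_pos x
  have hy := exp_pos y
  rw [← log_div (by positivity) (by positivity)]
  have key : (1 + exp y) / (1 + exp x) = (1 - sigmoid x) * 1 + sigmoid x * exp (y - x) := by
    rw [← exp_div_one_add_exp, exp_sub]
    field_simp
    ring
  have hne : (1 : ℝ) ≠ exp (y - x) := by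
    intro h'
    exact h (sub_eq_zero.1 (exp_eq_one_iff _ |>.1 h'.symm))
  have := strictConcaveOn_log_Ioi.2 (Set.mem_Ioi.2 one_pos) (Set.mem_Ioi.2 (exp_pos (y - x))) hne
    (sub_pos.2 (sigmoid_lt_one x)) (sigmoid_pos x) (by ring)
  rw [key]
  simpa using this

lemma logLik_lt {X : Type*} {η : ι → X → ℝ} {w : ι → ℝ} (hw : ∀ i, 0 ≤ w i) {θ₀ θ : X}
    (h : (fun i => w i * η i θ) ≠ fun i => w i * η i θ₀) :
    logLik η w (meanProp η w θ₀) θ < logLik η w (meanProp η w θ₀) θ₀ := by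
  have term : ∀ i, w i * η i θ ≠ w i * η i θ₀ →
      meanProp η w θ₀ i * η i θ - w i * log (1 + exp (η i θ)) <
      meanProp η w θ₀ i * η i θ₀ - w i * log (1 + exp (η i θ₀)) := by
    intro i hi
    have hw0 : w i ≠ 0 := by rintro h0; simp [h0] at hi
    have hne : η i θ ≠ η i θ₀ := by rintro h0; simp [h0] at hi
    have := mul_lt_mul_of_pos_left (mul_sub_lt_log_one_add_exp_sub hne)
      (lt_of_le_of_ne (hw i) hw0.symm)
    simp only [meanProp]
    linarith
  obtain ⟨i, hi⟩ := Function.ne_iff.1 h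
  refine Finset.sum_lt_sum (fun j _ => ?_) ⟨i, Finset.mem_univ i, term i hi⟩
  by_cases hj : w j * η j θ = w j * η j θ₀
  · rcases mul_eq_mul_left_iff.1 hj with hj | hj
    · rw [hj]
    · simp [meanProp, hj]
  · exact (term j hj).le

lemma eventually_logLik_lt [FiniteDimensional ℝ E] {η : ι → E → ℝ}
    (hη : ∀ i, ContDiff ℝ 2 (η i)) {w : ι → ℝ} (hw : ∀ i, 0 ≤ w i) {θ₀ : E}
    (hinj : ∀ v, (∀ i, w i * fderiv ℝ (η i) θ₀ v = 0) → v = 0) :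
    ∀ᶠ θ in 𝓝[≠] θ₀, logLik η w (meanProp η w θ₀) θ < logLik η w (meanProp η w θ₀) θ₀ := by
  have hd : HasFDerivAt (fun θ i => w i * η i θ)
      (ContinuousLinearMap.pi fun i => w i • fderiv ℝ (η i) θ₀) θ₀ :=
    hasFDerivAt_pi.2 fun i =>
      ((hη i).differentiable (by norm_num) θ₀).hasFDerivAt.const_mul (w i)
  obtain ⟨C, -, hC⟩ := LinearMap.exists_antilipschitzWith
    (ContinuousLinearMap.pi fun i => w i • fderiv ℝ (η i) θ₀ : E →L[ℝ] ι → ℝ).toLinearMap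
    (LinearMap.ker_eq_bot'.2 fun v hv => hinj v fun i => by simpa using congrFun hv i)
  filter_upwards [hd.eventually_ne (c := fun i => w i * η i θ₀) ⟨C, hC⟩] with θ hθ
  exact logLik_lt hw hθ

lemma continuous_logLik {X : Type*} [TopologicalSpace X] {η : ι → X → ℝ}
    (hη : ∀ i, Continuous (η i)) :
    Continuous fun x : ((ι → ℝ) × (ι → ℝ)) × X => logLik η x.1.1 x.1.2 x.2 := by
  unfold logLik
  have : ∀ i, Continuous fun x : ((ι → ℝ) × (ι → ℝ)) × X => log (1 + exp (η i x.2)) := fun i =>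
    Continuous.log (by have := hη i; fun_prop) fun x => by positivity
  fun_prop

lemma eventually_forall_logLik_lt {X : Type*} [TopologicalSpace X] {η : ι → X → ℝ}
    (hη : ∀ i, Continuous (η i)) {k p : ι → ℝ} {θ₀ : X} {s : Set X}
    (hs : IsCompact s) (h : ∀ θ ∈ s, logLik η k p θ < logLik η k p θ₀) :
    ∀ᶠ x : (ι → ℝ) × (ι → ℝ) in 𝓝 (k, p), ∀ θ ∈ s,
      logLik η x.1 x.2 θ < logLik η x.1 x.2 θ₀ := by
  refine hs.eventually_forall_of_forall_eventually
    (P := fun (x : (ι → ℝ) × (ι → ℝ)) θ => logLik η x.1 x.2 θ < logLik η x.1 x.2 θ₀) fun θ hθ => ?_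
  refine ContinuousAt.eventually_lt (continuous_logLik hη).continuousAt ?_ (h θ hθ)
  exact ((continuous_logLik hη).comp (continuous_fst.prodMk continuous_const)).continuousAt

/-- Lagrange multipliers at a local maximizer of the log-likelihood. -/
lemma exists_multiplier [CompleteSpace E] [FiniteDimensional ℝ F] {η : ι → E → ℝ}
    (hη : ∀ i, ContDiff ℝ 2 (η i))
    {k p : ι → ℝ} {m : E → F} {θ : E} (hm : ContDiffAt ℝ 1 m θ)
    (hsurj : Function.Surjective (fderiv ℝ m θ)) (hθ : m θ = 0)
    (hmax : IsLocalMaxOn (logLik η k p) {θ | m θ = 0} θ) :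
    ∃ Λ : F →L[ℝ] ℝ, score η k p θ + Λ.comp (fderiv ℝ m θ) = 0 := by
  rw [← hθ] at hmax
  have : CompleteSpace F := FiniteDimensional.complete ℝ F
  obtain ⟨Λ, c, hne, hΛ⟩ := IsLocalExtrOn.exists_linear_map_of_hasStrictFDerivAt
    (Or.inr hmax) (hm.hasStrictFDerivAt (by norm_num)) (hasStrictFDerivAt_logLik hη k p θ)
  have hc : c ≠ 0 := by
    rintro rfl
    refine hne (Prod.ext (LinearMap.ext fun y => ?_) rfl)
    obtain ⟨x, rfl⟩ := hsurj y
    simpa using hΛ x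
  refine ⟨c⁻¹ • LinearMap.toContinuousLinearMap Λ, ContinuousLinearMap.ext fun x => ?_⟩
  have := hΛ x
  simp only [smul_eq_mul] at this
  simp
  field_simp
  linarith

lemma score_sub_isLittleO {η : ι → E → ℝ} (hη : ∀ i, ContDiff ℝ 2 (η i)) (w : ι → ℝ) (θ₀ : E) :
    (fun x : ((ι → ℝ) × (ι → ℝ)) × E => score η x.1.1 x.1.2 x.2 - score η x.1.1 x.1.2 θ₀ +
      info η w θ₀ (x.2 - θ₀)) =o[𝓝 ((w, meanProp η w θ₀), θ₀)] fun x => x.2 - θ₀ := by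
  set l := 𝓝 ((w, meanProp η w θ₀), θ₀) with hl
  have hθ : Tendsto (fun x : ((ι → ℝ) × (ι → ℝ)) × E => x.2) l (𝓝 θ₀) :=
    continuous_snd.tendsto _
  have hk : ∀ i, Tendsto (fun x : ((ι → ℝ) × (ι → ℝ)) × E => x.1.1 i) l (𝓝 (w i)) := fun i =>
    Continuous.tendsto (by fun_prop : Continuous fun x : ((ι → ℝ) × (ι → ℝ)) × E => x.1.1 i) _
  have hp : ∀ i, Tendsto (fun x : ((ι → ℝ) × (ι → ℝ)) × E => x.1.2 i) l
      (𝓝 (w i * sigmoid (η i θ₀))) := fun i =>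
    Continuous.tendsto (by fun_prop : Continuous fun x : ((ι → ℝ) × (ι → ℝ)) × E => x.1.2 i) _
  have hterm : ∀ i ∈ (Finset.univ : Finset ι), (fun x : ((ι → ℝ) × (ι → ℝ)) × E =>
      (x.1.2 i - x.1.1 i * sigmoid (η i θ₀)) • (fderiv ℝ (η i) x.2 - fderiv ℝ (η i) θ₀)
      - (x.1.1 i * (sigmoid (η i x.2) - sigmoid (η i θ₀) -
          ((sigmoid (η i θ₀) * (1 - sigmoid (η i θ₀))) • fderiv ℝ (η i) θ₀) (x.2 - θ₀)))
        • fderiv ℝ (η i) x.2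
      - (((sigmoid (η i θ₀) * (1 - sigmoid (η i θ₀))) • fderiv ℝ (η i) θ₀) (x.2 - θ₀)) •
        (x.1.1 i • fderiv ℝ (η i) x.2 - w i • fderiv ℝ (η i) θ₀)) =o[l] fun x => x.2 - θ₀ := by
    intro i _
    have hηd : HasFDerivAt (η i) (fderiv ℝ (η i) θ₀) θ₀ :=
      ((hη i).differentiable (by norm_num) θ₀).hasFDerivAt
    have hσ : HasFDerivAt (fun θ => sigmoid (η i θ))
        ((sigmoid (η i θ₀) * (1 - sigmoid (η i θ₀))) • fderiv ℝ (η i) θ₀) θ₀ :=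
      (hasDerivAt_sigmoid (η i θ₀)).comp_hasFDerivAt θ₀ hηd
    have hD : ContDiff ℝ 1 (fderiv ℝ (η i)) := (hη i).fderiv_right (by norm_num)
    have hDO : (fun θ => fderiv ℝ (η i) θ - fderiv ℝ (η i) θ₀) =O[𝓝 θ₀] fun θ => θ - θ₀ :=
      (hD.differentiable (by norm_num) θ₀).isBigO_sub
    have hDt : Tendsto (fun x : ((ι → ℝ) × (ι → ℝ)) × E => fderiv ℝ (η i) x.2) l
        (𝓝 (fderiv ℝ (η i) θ₀)) := (hD.continuous.tendsto θ₀).comp hθ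
    refine IsLittleO.sub (IsLittleO.sub ?_ ?_) ?_
    · have h1 : (fun x : ((ι → ℝ) × (ι → ℝ)) × E => x.1.2 i - x.1.1 i * sigmoid (η i θ₀))
          =o[l] fun _ => (1 : ℝ) := by
        rw [isLittleO_one_iff]
        simpa using (hp i).sub ((hk i).mul_const (sigmoid (η i θ₀)))
      simpa using (h1.smul_isBigO (hDO.comp_tendsto hθ)).norm_right
    · have h1 := (hσ.isLittleO.comp_tendsto hθ)
      have h2 := (((hk i).isBigO_one ℝ).mul_isLittleO h1.norm_right).smul_isBigO (hDt.isBigO_one ℝ)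
      simpa using h2
    · have h1 : (fun x : ((ι → ℝ) × (ι → ℝ)) × E =>
          x.1.1 i • fderiv ℝ (η i) x.2 - w i • fderiv ℝ (η i) θ₀) =o[l] fun _ => (1 : ℝ) := by
        rw [isLittleO_one_iff]
        simpa using ((hk i).smul hDt).sub_const (w i • fderiv ℝ (η i) θ₀)
      have h2 : (fun x : ((ι → ℝ) × (ι → ℝ)) × E =>
          ((sigmoid (η i θ₀) * (1 - sigmoid (η i θ₀))) • fderiv ℝ (η i) θ₀) (x.2 - θ₀))
          =O[l] fun x => x.2 - θ₀ := ContinuousLinearMap.isBigO_comp _ _ _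
      simpa using h2.norm_right.smul_isLittleO h1
  refine (IsLittleO.fun_sum hterm).congr_left fun x => ?_
  simp only [score, info, _root_.sum_apply, ← Finset.sum_sub_distrib,
    ← Finset.sum_add_distrib]
  refine Finset.sum_congr rfl fun i _ => ContinuousLinearMap.ext fun v => ?_
  simp
  ring

lemma eventually_surjective [FiniteDimensional ℝ F] {X : Type*} {l : Filter X}
    {f : X → E →L[ℝ] F} {B : E →L[ℝ] F} (hf : Tendsto f l (𝓝 B)) (hB : Function.Surjective B) :
    ∀ᶠ x in l, Function.Surjective (f x) := by
  have : CompleteSpace F := FiniteDimensional.complete ℝ F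
  obtain ⟨R, hR⟩ := B.exists_rightInverse_of_surjective (LinearMap.range_eq_top.2 hB)
  have h : Tendsto (fun x => (f x).comp R) l (𝓝 (1 : F →L[ℝ] F)) := by
    have := (((ContinuousLinearMap.compL ℝ F E F).flip R).continuous.tendsto B).comp hf
    rw [show ((ContinuousLinearMap.compL ℝ F E F).flip R) B = 1 from hR] at this
    exact this
  filter_upwards [h.eventually (Units.isOpen.mem_nhds isUnit_one)] with x hx y
  obtain ⟨u, hu⟩ := hx
  refine ⟨R (((u⁻¹ : (F →L[ℝ] F)ˣ) : F →L[ℝ] F) y), ?_⟩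
  have : ((u : F →L[ℝ] F) * ((u⁻¹ : (F →L[ℝ] F)ˣ) : F →L[ℝ] F)) y = y := by simp
  rw [hu] at this
  exact this

lemma norm_multiplier_le {B D : E →L[ℝ] F} {R : F →L[ℝ] E} (hR : B.comp R = .id ℝ F)
    (h : ‖D - B‖ * ‖R‖ ≤ 1 / 2) (Λ : F →L[ℝ] ℝ) : ‖Λ‖ ≤ 2 * ‖R‖ * ‖Λ.comp D‖ := by
  have hΛR : Λ = (Λ.comp D).comp R - (Λ.comp (D - B)).comp R := by
    rw [← ContinuousLinearMap.sub_comp, ← ContinuousLinearMap.comp_sub, sub_sub_cancel,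
      ContinuousLinearMap.comp_assoc, hR, ContinuousLinearMap.comp_id]
  have a2 : ‖(Λ.comp (D - B)).comp R‖ ≤ ‖Λ‖ * ‖D - B‖ * ‖R‖ :=
    (ContinuousLinearMap.opNorm_comp_le _ _).trans
      (mul_le_mul_of_nonneg_right (ContinuousLinearMap.opNorm_comp_le _ _) (norm_nonneg R))
  have a3 : ‖Λ‖ ≤ ‖Λ.comp D‖ * ‖R‖ + ‖Λ‖ * ‖D - B‖ * ‖R‖ :=
    calc ‖Λ‖ = ‖(Λ.comp D).comp R - (Λ.comp (D - B)).comp R‖ := by rw [← hΛR]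
      _ ≤ _ := (norm_sub_le _ _).trans
        (add_le_add (ContinuousLinearMap.opNorm_comp_le _ _) a2)
  have a4 := mul_le_mul_of_nonneg_left h (norm_nonneg Λ)
  linarith

lemma norm_sub_le_of_multiplier {B D : E →L[ℝ] F} {R Q : F →L[ℝ] E} {A : E →L[ℝ] E →L[ℝ] ℝ}
    {S : (E →L[ℝ] ℝ) →L[ℝ] E} (hR : B.comp R = .id ℝ F)
    (hS : ∀ Λ : F →L[ℝ] ℝ, S (Λ.comp B) = 0) (hQ : ∀ v, S (A v) = v - Q (B v))
    {s s₀ : E →L[ℝ] ℝ} {δ : E} {Λ : F →L[ℝ] ℝ} {ε : ℝ} (hε : ε ≤ 1)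
    (hDB : ‖D - B‖ ≤ ε) (hεR : ε * ‖R‖ ≤ 1 / 2) (hs : ‖s - s₀ + A δ‖ ≤ ε * ‖δ‖)
    (hBδ : ‖B δ‖ ≤ ε * ‖δ‖) (hΛ : s + Λ.comp D = 0) :
    ‖δ - S s₀‖ ≤ ε * (‖S‖ + ‖Q‖ + 2 * ‖S‖ * ‖R‖ * (‖A‖ + 1)) * (‖δ‖ + ‖s₀‖) := by
  have hε0 : 0 ≤ ε := (norm_nonneg _).trans hDB
  have hs' : Λ.comp D = -s := (neg_eq_of_add_eq_zero_right hΛ).symm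
  have hΛs : ‖Λ‖ ≤ 2 * ‖R‖ * ‖s‖ := by
    have := norm_multiplier_le (D := D) hR
      ((mul_le_mul_of_nonneg_right hDB (norm_nonneg R)).trans hεR) Λ
    rwa [hs', norm_neg] at this
  have hsn : ‖s‖ ≤ ‖s₀‖ + (‖A‖ + 1) * ‖δ‖ := by
    have a1 : s₀ - A δ + (s - s₀ + A δ) = s := by abel
    have a2 := A.le_opNorm δ
    have a3 := mul_le_mul_of_nonneg_right hε (norm_nonneg δ)
    have a4 := norm_add_le (s₀ - A δ) (s - s₀ + A δ)
    have a5 := norm_sub_le s₀ (A δ)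
    rw [a1] at a4
    linarith
  have hSs : ‖S s‖ ≤ ‖S‖ * (2 * ‖R‖ * (‖s₀‖ + (‖A‖ + 1) * ‖δ‖) * ε) := by
    have a1 : S s = -S (Λ.comp (D - B)) := by
      rw [ContinuousLinearMap.comp_sub, map_sub, hS, sub_zero, hs', map_neg, neg_neg]
    rw [a1, norm_neg]
    refine (S.le_opNorm _).trans (mul_le_mul_of_nonneg_left ?_ (norm_nonneg S))
    refine (ContinuousLinearMap.opNorm_comp_le _ _).trans ?_
    exact mul_le_mul (hΛs.trans (by gcongr)) hDB (norm_nonneg _) (by positivity)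
  have hSr : ‖S (s - s₀ + A δ)‖ ≤ ‖S‖ * (ε * ‖δ‖) :=
    (S.le_opNorm _).trans (mul_le_mul_of_nonneg_left hs (norm_nonneg S))
  have hQB : ‖Q (B δ)‖ ≤ ‖Q‖ * (ε * ‖δ‖) :=
    (Q.le_opNorm _).trans (mul_le_mul_of_nonneg_left hBδ (norm_nonneg Q))
  have key : δ - S s₀ = S (s - s₀ + A δ) - S s + Q (B δ) := by
    rw [map_add, map_sub, hQ]; abel
  have h1 : ‖δ - S s₀‖ ≤ ‖S (s - s₀ + A δ)‖ + ‖S s‖ + ‖Q (B δ)‖ := by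
    rw [key]
    exact (norm_add_le _ _).trans (add_le_add_left (norm_sub_le _ _) _)
  have h2 : 0 ≤ ε * ((‖S‖ + ‖Q‖ + 2 * ‖S‖ * ‖R‖ * ‖A‖) * ‖s₀‖) := by positivity
  linarith

/-- Consistent solutions of the restricted likelihood equations are asymptotically linear in the
score at the true parameter. -/
lemma eventually_root_expansion [FiniteDimensional ℝ F] {η : ι → E → ℝ}
    (hη : ∀ i, ContDiff ℝ 2 (η i)) {w : ι → ℝ} {θ₀ : E} {m : E → F}
    (hm : ContDiffAt ℝ 1 m θ₀) (hsurj : Function.Surjective (fderiv ℝ m θ₀))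
    {S : (E →L[ℝ] ℝ) →L[ℝ] E} {Q : F →L[ℝ] E}
    (hS : ∀ Λ : F →L[ℝ] ℝ, S (Λ.comp (fderiv ℝ m θ₀)) = 0)
    (hQ : ∀ v, S (info η w θ₀ v) = v - Q (fderiv ℝ m θ₀ v)) {ε : ℝ} (hε : 0 < ε) :
    ∀ᶠ x : ((ι → ℝ) × (ι → ℝ)) × E in 𝓝 ((w, meanProp η w θ₀), θ₀),
      m x.2 = m θ₀ → (∃ Λ : F →L[ℝ] ℝ, score η x.1.1 x.1.2 x.2 + Λ.comp (fderiv ℝ m x.2) = 0) →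
      ‖x.2 - θ₀ - S (score η x.1.1 x.1.2 θ₀)‖ ≤ ε * ‖score η x.1.1 x.1.2 θ₀‖ := by
  obtain ⟨R, hR⟩ := (fderiv ℝ m θ₀).exists_rightInverse_of_surjective
    (LinearMap.range_eq_top.2 hsurj)
  obtain ⟨C, hC⟩ : ∃ C : ℝ, C = ‖S‖ + ‖Q‖ + 2 * ‖S‖ * ‖R‖ * (‖info η w θ₀‖ + 1) := ⟨_, rfl⟩
  have hC0 : 0 ≤ C := by rw [hC]; positivity
  obtain ⟨ε₂, hε₂0, hε₂1, hε₂2⟩ : ∃ ε₂ : ℝ, 0 < ε₂ ∧ ε₂ ≤ 1 / 2 ∧ ε₂ * (2 * ‖S‖ + 2) ≤ ε := by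
    refine ⟨min (1 / 2) (ε / (2 * ‖S‖ + 2)), by positivity, min_le_left _ _, ?_⟩
    rw [← le_div_iff₀ (by positivity)]
    exact min_le_right _ _
  obtain ⟨ε₁, hε₁0, hε₁1, hε₁R, hε₁C⟩ :
      ∃ ε₁ : ℝ, 0 < ε₁ ∧ ε₁ ≤ 1 ∧ ε₁ * ‖R‖ ≤ 1 / 2 ∧ ε₁ * C ≤ ε₂ := by
    have h1 : ∀ᶠ t : ℝ in 𝓝[>] 0, t * ‖R‖ < 1 / 2 := by
      refine (Tendsto.mono_left ?_ nhdsWithin_le_nhds).eventually_lt_const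
        (show (0 : ℝ) < 1 / 2 by norm_num)
      simpa using (continuous_mul_const ‖R‖).tendsto (0 : ℝ)
    have h2 : ∀ᶠ t : ℝ in 𝓝[>] 0, t * C < ε₂ := by
      refine (Tendsto.mono_left ?_ nhdsWithin_le_nhds).eventually_lt_const hε₂0
      simpa using (continuous_mul_const C).tendsto (0 : ℝ)
    have h3 : ∀ᶠ t : ℝ in 𝓝[>] 0, t ≤ 1 :=
      nhdsWithin_le_nhds (Iic_mem_nhds one_pos)
    obtain ⟨t, ht⟩ := ((h1.and h2).and (h3.and self_mem_nhdsWithin)).exists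
    exact ⟨t, ht.2.2, ht.2.1, ht.1.1.le, ht.1.2.le⟩
  have hθ : Tendsto (fun x : ((ι → ℝ) × (ι → ℝ)) × E => x.2) (𝓝 ((w, meanProp η w θ₀), θ₀))
      (𝓝 θ₀) := continuous_snd.tendsto _
  have e1 := (score_sub_isLittleO hη w θ₀).bound hε₁0
  have e2 := hθ.eventually
    ((hm.differentiableAt (by norm_num)).hasFDerivAt.isLittleO.bound hε₁0)
  have e3 : ∀ᶠ θ in 𝓝 θ₀, ‖fderiv ℝ m θ - fderiv ℝ m θ₀‖ < ε₁ := by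
    have : ContinuousAt (fderiv ℝ m) θ₀ := (hm.fderiv_right (m := 0) (by norm_num)).continuousAt
    simpa [dist_eq_norm] using Metric.tendsto_nhds.1 this ε₁ hε₁0
  filter_upwards [e1, e2, hθ.eventually e3] with x h1 h2 h3 hx hroot
  obtain ⟨Λ, hΛ⟩ := hroot
  rw [hx, sub_self, zero_sub, norm_neg] at h2
  have h4 := norm_sub_le_of_multiplier hR hS hQ hε₁1 h3.le hε₁R h1 h2 hΛ
  rw [← hC] at h4
  generalize score η x.1.1 x.1.2 θ₀ = s₀ at *
  generalize x.2 - θ₀ = δ at *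
  have h5 : ‖δ - S s₀‖ ≤ ε₂ * (‖δ‖ + ‖s₀‖) :=
    h4.trans (mul_le_mul_of_nonneg_right hε₁C (by positivity))
  have h6 : ‖δ‖ ≤ (2 * ‖S‖ + 1) * ‖s₀‖ := by
    have a1 : ‖δ‖ ≤ ‖δ - S s₀‖ + ‖S s₀‖ := by simpa using norm_add_le (δ - S s₀) (S s₀)
    have a2 := S.le_opNorm s₀
    have a3 := mul_le_mul_of_nonneg_right hε₂1 (add_nonneg (norm_nonneg δ) (norm_nonneg s₀))
    linarith
  calc ‖δ - S s₀‖ ≤ ε₂ * (‖δ‖ + ‖s₀‖) := h5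
    _ ≤ ε₂ * ((2 * ‖S‖ + 1) * ‖s₀‖ + ‖s₀‖) := by gcongr
    _ = ε₂ * (2 * ‖S‖ + 2) * ‖s₀‖ := by ring
    _ ≤ ε * ‖s₀‖ := by gcongr

/-- Restricted maximizers over a small closed ball around the true parameter are consistent local
maximizers and solve the restricted likelihood equations. -/
lemma exists_local_maximizer [FiniteDimensional ℝ E] [FiniteDimensional ℝ F] {η : ι → E → ℝ}
    (hη : ∀ i, ContDiff ℝ 2 (η i)) {w : ι → ℝ} (hw : ∀ i, 0 ≤ w i) {θ₀ : E} {m : E → F}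
    (hm : ContDiffAt ℝ 1 m θ₀) (hsurj : Function.Surjective (fderiv ℝ m θ₀)) (hθ₀ : m θ₀ = 0)
    (hinj : ∀ v, (∀ i, w i * fderiv ℝ (η i) θ₀ v = 0) → v = 0) :
    ∃ e : (ι → ℝ) × (ι → ℝ) → E, Tendsto e (𝓝 (w, meanProp η w θ₀)) (𝓝 θ₀) ∧
      ∀ᶠ x in 𝓝 (w, meanProp η w θ₀), m (e x) = 0 ∧
        IsLocalMaxOn (logLik η x.1 x.2) {θ | m θ = 0} (e x) := by
  have hproper : ProperSpace E := FiniteDimensional.proper ℝ E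
  have hcont : ∀ i, Continuous (η i) := fun i => (hη i).continuous
  obtain ⟨ρ₀, hρ₀, hball⟩ : ∃ ρ₀ > 0, ∀ θ ∈ Metric.closedBall θ₀ ρ₀, ContinuousAt m θ ∧
      (θ ≠ θ₀ → logLik η w (meanProp η w θ₀) θ < logLik η w (meanProp η w θ₀) θ₀) := by
    have h1 := (hm.eventually (by norm_num)).mono fun θ h => h.continuousAt
    have h2 := eventually_nhdsWithin_iff.1 (eventually_logLik_lt hη hw hinj)
    exact (Metric.nhds_basis_closedBall.eventually_iff).1 (h1.and h2)
  set s : Set E := Metric.closedBall θ₀ ρ₀ ∩ {θ | m θ = 0} with hs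
  have hsc : IsCompact s := by
    have hmc : ContinuousOn m (Metric.closedBall θ₀ ρ₀) := fun θ hθ =>
      (hball θ hθ).1.continuousWithinAt
    exact (isCompact_closedBall θ₀ ρ₀).of_isClosed_subset
      (hmc.preimage_isClosed_of_isClosed Metric.isClosed_closedBall isClosed_singleton)
      Set.inter_subset_left
  have hθ₀s : θ₀ ∈ s := ⟨Metric.mem_closedBall_self hρ₀.le, hθ₀⟩
  have hex : ∀ x : (ι → ℝ) × (ι → ℝ), ∃ θ ∈ s, IsMaxOn (logLik η x.1 x.2) s θ := fun x =>
    hsc.exists_isMaxOn ⟨θ₀, hθ₀s⟩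
      ((continuous_logLik hcont).comp (continuous_const (y := x).prodMk continuous_id)).continuousOn
  choose e hes hemax using hex
  have hlim : Tendsto e (𝓝 (w, meanProp η w θ₀)) (𝓝 θ₀) := by
    refine Metric.tendsto_nhds.2 fun ρ hρ => ?_
    have hK : IsCompact (Metric.closedBall θ₀ ρ₀ \ Metric.ball θ₀ ρ) :=
      (isCompact_closedBall θ₀ ρ₀).diff Metric.isOpen_ball
    have hlt : ∀ θ ∈ Metric.closedBall θ₀ ρ₀ \ Metric.ball θ₀ ρ,
        logLik η w (meanProp η w θ₀) θ < logLik η w (meanProp η w θ₀) θ₀ := fun θ hθ =>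
      (hball θ hθ.1).2 (by rintro rfl; exact hθ.2 (Metric.mem_ball_self hρ))
    filter_upwards [eventually_forall_logLik_lt hcont hK hlt] with x hx
    by_contra h
    exact absurd (hemax x hθ₀s) (not_le.2 (hx (e x) ⟨(hes x).1, h⟩))
  refine ⟨e, hlim, ?_⟩
  filter_upwards [hlim.eventually (Metric.ball_mem_nhds θ₀ hρ₀)] with x hx
  refine ⟨(hes x).2, ?_⟩
  filter_upwards [nhdsWithin_le_nhds (Metric.isOpen_ball.mem_nhds hx), self_mem_nhdsWithin]
    with θ h1 h2
  exact hemax x ⟨Metric.ball_subset_closedBall h1, h2⟩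

end BinomialLogit

end

noncomputable section

/-! ### Linear algebra of the restricted covariance matrix -/

namespace Matrix

variable {n r : Type*} [Fintype n] [DecidableEq n] [Fintype r] [DecidableEq r]

/-- The covariance matrix `A⁻¹ (A - M (Mᵀ A⁻¹ M)⁻¹ Mᵀ) A⁻¹`. -/
def restrictedCov (A : Matrix n n ℝ) (M : Matrix n r ℝ) : Matrix n n ℝ :=
  A⁻¹ * (A - M * (Mᵀ * A⁻¹ * M)⁻¹ * Mᵀ) * A⁻¹

variable {A : Matrix n n ℝ} {M : Matrix n r ℝ}

lemma restrictedCov_eq (hA : A.PosDef) :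
    restrictedCov A M = A⁻¹ - A⁻¹ * M * (Mᵀ * A⁻¹ * M)⁻¹ * Mᵀ * A⁻¹ := by
  have hu : IsUnit A.det := (isUnit_iff_isUnit_det A).1 hA.isUnit
  simp only [restrictedCov, Matrix.mul_sub, Matrix.sub_mul, nonsing_inv_mul A hu, Matrix.one_mul,
    Matrix.mul_assoc]

lemma isUnit_det_transpose_mul_inv_mul (hA : A.PosDef) (hM : Function.Injective M.mulVec) :
    IsUnit (Mᵀ * A⁻¹ * M).det := by
  have := hA.inv.conjTranspose_mul_mul_same hM
  rw [conjTranspose_eq_transpose_of_trivial] at this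
  exact (isUnit_iff_isUnit_det _).1 this.isUnit

lemma restrictedCov_mul_constraint (hA : A.PosDef) (hM : Function.Injective M.mulVec) :
    restrictedCov A M * M = 0 := by
  have h := nonsing_inv_mul _ (isUnit_det_transpose_mul_inv_mul hA hM)
  rw [restrictedCov_eq hA, Matrix.sub_mul, sub_eq_zero]
  calc A⁻¹ * M = A⁻¹ * M * ((Mᵀ * A⁻¹ * M)⁻¹ * (Mᵀ * A⁻¹ * M)) := by rw [h, Matrix.mul_one]
    _ = _ := by simp only [Matrix.mul_assoc]

lemma restrictedCov_mul (hA : A.PosDef) :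
    restrictedCov A M * A = 1 - A⁻¹ * M * (Mᵀ * A⁻¹ * M)⁻¹ * Mᵀ := by
  have hu : IsUnit A.det := (isUnit_iff_isUnit_det A).1 hA.isUnit
  rw [restrictedCov_eq hA, Matrix.sub_mul, Matrix.mul_assoc _ A⁻¹ A, nonsing_inv_mul A hu,
    Matrix.mul_one]

lemma transpose_restrictedCov (hA : A.PosDef) : (restrictedCov A M)ᵀ = restrictedCov A M := by
  have h : Aᵀ = A := by simpa [conjTranspose_eq_transpose_of_trivial] using hA.isHermitian.eq
  rw [restrictedCov_eq hA]
  simp only [transpose_sub, transpose_mul, transpose_nonsing_inv, transpose_transpose, h,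
    Matrix.mul_assoc]

lemma restrictedCov_mul_mul_transpose (hA : A.PosDef) (hM : Function.Injective M.mulVec) :
    restrictedCov A M * A * (restrictedCov A M)ᵀ = restrictedCov A M := by
  have h : Mᵀ * restrictedCov A M = 0 := by
    rw [← transpose_restrictedCov hA, ← transpose_mul, restrictedCov_mul_constraint hA hM,
      transpose_zero]
  rw [transpose_restrictedCov hA, restrictedCov_mul hA, Matrix.sub_mul, Matrix.one_mul,
    Matrix.mul_assoc _ Mᵀ, h, Matrix.mul_zero, sub_zero]

lemma posSemidef_restrictedCov (hA : A.PosDef) (hM : Function.Injective M.mulVec) :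
    (restrictedCov A M).PosSemidef := by
  have := hA.posSemidef.mul_mul_conjTranspose_same (restrictedCov A M)
  rwa [conjTranspose_eq_transpose_of_trivial, restrictedCov_mul_mul_transpose hA hM] at this

end Matrix

namespace OneShot

open BinomialLogit Matrix

variable {I J r : ℕ}

/-- The logit of the probability of failure. -/
def logit (D : Design I J) (i : Fin I) (θ : Param J) : ℝ :=
  Real.exp (∑ j, θ (Sum.inr j) * D.x i j) *
    (Real.log (D.τ i) - ∑ j, θ (Sum.inl j) * D.x i j)

/-- The gradient of the logit. -/
def logitGrad (D : Design I J) (i : Fin I) (θ : Param J) : Fin (J + 1) ⊕ Fin (J + 1) → ℝ :=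
  Sum.elim (fun j => -shape D θ i * D.x i j)
    (fun j => Real.log (D.τ i / scale D θ i) * shape D θ i * D.x i j)

lemma log_div_scale (D : Design I J) (i : Fin I) (θ : Param J) :
    Real.log (D.τ i / scale D θ i) = Real.log (D.τ i) - ∑ j, θ (Sum.inl j) * D.x i j := by
  rw [scale, Real.log_div (D.τ_pos i).ne' (Real.exp_pos _).ne', Real.log_exp]

lemma logit_eq (D : Design I J) (i : Fin I) (θ : Param J) :
    logit D i θ = shape D θ i * Real.log (D.τ i / scale D θ i) := by
  rw [log_div_scale]; rfl

lemma contDiff_logit (D : Design I J) (i : Fin I) : ContDiff ℝ 2 (logit D i) := by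
  unfold logit
  fun_prop

lemma fderiv_logit (D : Design I J) (i : Fin I) (θ v : Param J) :
    fderiv ℝ (logit D i) θ v = logitGrad D i θ ⬝ᵥ v := by
  have hlin : ∀ f : Fin (J + 1) → Fin (J + 1) ⊕ Fin (J + 1), HasFDerivAt
      (fun θ : Param J => ∑ j, θ (f j) * D.x i j)
      (∑ j, D.x i j • (EuclideanSpace.proj (f j) : Param J →L[ℝ] ℝ)) θ := fun f =>
    HasFDerivAt.fun_sum fun j _ =>
      (EuclideanSpace.proj (f j) : Param J →L[ℝ] ℝ).hasFDerivAt.mul_const (D.x i j)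
  have h : HasFDerivAt (logit D i) _ θ :=
    (hlin Sum.inr).exp.mul ((hlin Sum.inl).const_sub (Real.log (D.τ i)))
  rw [h.fderiv]
  simp only [logitGrad, dotProduct, Fintype.sum_sum_type, Sum.elim_inl, Sum.elim_inr,
    log_div_scale, shape]
  simp [Finset.mul_sum, _root_.sum_apply, mul_comm, mul_left_comm, mul_assoc]

lemma div_rpow_add_rpow_eq_sigmoid {τ α : ℝ} (hτ : 0 < τ) (hα : 0 < α) (β : ℝ) :
    τ ^ β / (τ ^ β + α ^ β) = Real.sigmoid (β * Real.log (τ / α)) := by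
  have h1 : 0 < τ ^ β := Real.rpow_pos_of_pos hτ β
  have h2 : 0 < α ^ β := Real.rpow_pos_of_pos hα β
  have h3 : Real.exp (β * Real.log (τ / α)) = τ ^ β / α ^ β := by
    rw [← Real.div_rpow hτ.le hα.le, Real.rpow_def_of_pos (div_pos hτ hα), mul_comm]
  rw [← exp_div_one_add_exp, h3]
  field_simp
  ring

lemma scale_pos (D : Design I J) (θ : Param J) (i : Fin I) : 0 < scale D θ i := Real.exp_pos _

lemma failProb_eq (D : Design I J) (θ : Param J) (i : Fin I) :
    failProb D θ i = Real.sigmoid (logit D i θ) := by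
  rw [failProb, logLogisticCDF, if_pos (D.τ_pos i),
    div_rpow_add_rpow_eq_sigmoid (D.τ_pos i) (scale_pos D θ i), logit_eq]

lemma likelihood_eq_exp_logLik (D : Design I J) {Ks n : Fin I → ℕ} (hn : ∀ i, n i ≤ Ks i)
    (θ : Param J) : likelihood D Ks n θ =
      Real.exp (logLik (logit D) (fun i => (Ks i : ℝ)) (fun i => (n i : ℝ)) θ) := by
  rw [likelihood, logLik, Real.exp_sum]
  refine Finset.prod_congr rfl fun i _ => ?_
  have h0 : 0 < 1 + Real.exp (logit D i θ) := by positivity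
  have h1 : failProb D θ i = Real.exp (logit D i θ) * (1 + Real.exp (logit D i θ))⁻¹ := by
    rw [failProb_eq, ← exp_div_one_add_exp, div_eq_mul_inv]
  have h2 : reliability D θ i = (1 + Real.exp (logit D i θ))⁻¹ := by
    rw [reliability, h1]; field_simp; ring
  rw [h1, h2, mul_pow, mul_assoc, ← pow_add, Nat.add_sub_cancel' (hn i), sub_eq_add_neg,
    Real.exp_add, ← mul_neg, ← Real.log_inv, Real.exp_nat_mul, Real.exp_nat_mul,
    Real.exp_log (inv_pos.2 h0)]

lemma estimatingFun_zero (D : Design I J) (Ks n : Fin I → ℕ) (θ : Param J) :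
    estimatingFun D Ks n 0 θ =
      ∑ i, ((Ks i : ℝ) * Real.sigmoid (logit D i θ) - n i) • logitGrad D i θ := by
  refine Finset.sum_congr rfl fun i _ => ?_
  have h1 : 0 < D.τ i ^ shape D θ i := Real.rpow_pos_of_pos (D.τ_pos i) _
  have h2 : 0 < scale D θ i ^ shape D θ i := Real.rpow_pos_of_pos (scale_pos D θ i) _
  rw [div_rpow_add_rpow_eq_sigmoid (D.τ_pos i) (scale_pos D θ i), ← logit_eq, mul_zero,
    Real.rpow_zero, Real.rpow_zero, one_mul, one_mul, zero_add, Real.rpow_one,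
    add_comm (scale D θ i ^ _), div_self (by positivity), mul_one]
  rfl

lemma score_single (D : Design I J) (k p : Fin I → ℝ) (θ : Param J)
    (q : Fin (J + 1) ⊕ Fin (J + 1)) : score (logit D) k p θ (EuclideanSpace.single q 1) =
      -(∑ i, (k i * Real.sigmoid (logit D i θ) - p i) • logitGrad D i θ) q := by
  simp only [score, _root_.sum_apply, Finset.sum_apply, Pi.smul_apply, smul_eq_mul,
    _root_.smul_apply, fderiv_logit, ← Finset.sum_neg_distrib]
  refine Finset.sum_congr rfl fun i _ => ?_
  simp
  ring

lemma ext_single {G : Type*} [NormedAddCommGroup G] [NormedSpace ℝ G] {f g : Param J →L[ℝ] G}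
    (h : ∀ q, f (EuclideanSpace.single q 1) = g (EuclideanSpace.single q 1)) : f = g := by
  refine ContinuousLinearMap.coe_injective
    ((EuclideanSpace.basisFun (Fin (J + 1) ⊕ Fin (J + 1)) ℝ).toBasis.ext fun q => ?_)
  simpa using h q

lemma isRestrictedRoot_zero_iff (D : Design I J) (m : Param J → EuclideanSpace ℝ (Fin r))
    (Ks n : Fin I → ℕ) (θ : Param J) : IsRestrictedRoot D m Ks n 0 θ ↔
      (∃ Λ : EuclideanSpace ℝ (Fin r) →L[ℝ] ℝ,
        score (logit D) (fun i => (Ks i : ℝ)) (fun i => (n i : ℝ)) θ +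
          Λ.comp (fderiv ℝ m θ) = 0) ∧ m θ = 0 := by
  refine and_congr_left fun _ => ?_
  rw [estimatingFun_zero]
  constructor
  · rintro ⟨lam, h⟩
    refine ⟨-∑ s, lam s • EuclideanSpace.proj s, ext_single fun q => ?_⟩
    have := congrFun h q
    simp only [Pi.add_apply, Pi.zero_apply, mulVec, dotProduct, constraintMatrix,
      Matrix.of_apply] at this
    rw [_root_.add_apply, score_single]
    simp only [ContinuousLinearMap.comp_apply, _root_.neg_apply, _root_.sum_apply,
      _root_.smul_apply, PiLp.proj_apply, smul_eq_mul, _root_.zero_apply,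
      mul_comm (lam _)]
    linarith
  · rintro ⟨Λ, h⟩
    refine ⟨fun s => -Λ (EuclideanSpace.single s 1), funext fun q => ?_⟩
    have := DFunLike.congr_fun h (EuclideanSpace.single q 1)
    rw [_root_.add_apply, score_single, ContinuousLinearMap.comp_apply] at this
    have h2 : ∀ y : EuclideanSpace ℝ (Fin r),
        Λ y = ∑ s, y s * Λ (EuclideanSpace.single s 1) := fun y => by
      conv_lhs => rw [← (EuclideanSpace.basisFun (Fin r) ℝ).sum_repr y]
      simp
    rw [h2] at this
    simp only [Pi.add_apply, Pi.zero_apply, mulVec, dotProduct, constraintMatrix,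
      Matrix.of_apply, mul_neg, Finset.sum_neg_distrib, _root_.zero_apply] at this ⊢
    linarith

lemma fisherInfo_eq (D : Design I J) (w : Fin I → ℝ) (θ : Param J) :
    fisherInfo D w θ = ∑ i, (w i * (Real.sigmoid (logit D i θ) *
      (1 - Real.sigmoid (logit D i θ)))) • vecMulVec (logitGrad D i θ) (logitGrad D i θ) := by
  refine Finset.sum_congr rfl fun i _ => ?_
  have h1 := Real.sigmoid_pos (logit D i θ)
  have h2 := sub_pos.2 (Real.sigmoid_lt_one (logit D i θ))
  congr 1
  · rw [reliability, failProb_eq]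
    field_simp
    ring
  · ext p q
    rcases p with p | p <;> rcases q with q | q <;>
      simp [condMatrix, logitGrad, vecMulVec_apply] <;> ring

lemma posSemidef_fisherInfo (D : Design I J) {w : Fin I → ℝ} (hw : ∀ i, 0 ≤ w i) (θ : Param J) :
    (fisherInfo D w θ).PosSemidef := by
  rw [fisherInfo_eq]
  refine posSemidef_sum _ fun i _ => ?_
  have h : (vecMulVec (logitGrad D i θ) (logitGrad D i θ)).PosSemidef := by
    simpa using posSemidef_vecMulVec_self_star (logitGrad D i θ)
  exact h.smul (mul_nonneg (hw i) (mul_nonneg (Real.sigmoid_nonneg _)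
    (sub_nonneg.2 (Real.sigmoid_le_one _))))

lemma fisherInfo_mulVec (D : Design I J) (w : Fin I → ℝ) (θ v : Param J) :
    fisherInfo D w θ *ᵥ v = ∑ i, (w i * (Real.sigmoid (logit D i θ) *
      (1 - Real.sigmoid (logit D i θ))) * fderiv ℝ (logit D i) θ v) • logitGrad D i θ := by
  rw [fisherInfo_eq, Matrix.sum_mulVec]
  refine Finset.sum_congr rfl fun i _ => ?_
  rw [smul_mulVec, vecMulVec_mulVec, fderiv_logit]
  simp [smul_smul, mul_assoc]

lemma eq_zero_of_fderiv_logit (D : Design I J) {w : Fin I → ℝ} {θ v : Param J}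
    (hI : IsUnit (fisherInfo D w θ).det)
    (hv : ∀ i, w i * fderiv ℝ (logit D i) θ v = 0) : v = 0 := by
  have h : fisherInfo D w θ *ᵥ v = 0 := by
    rw [fisherInfo_mulVec]
    refine Finset.sum_eq_zero fun i _ => ?_
    rw [mul_right_comm, hv i, zero_mul, zero_smul]
  have := eq_zero_of_mulVec_eq_zero hI.ne_zero h
  ext q
  exact congrFun this q

lemma constraintMatrix_transpose_mulVec (m : Param J → EuclideanSpace ℝ (Fin r))
    (θ v : Param J) : (constraintMatrix m θ)ᵀ *ᵥ v = fderiv ℝ m θ v := by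
  ext s
  conv_rhs => rw [← (EuclideanSpace.basisFun (Fin (J + 1) ⊕ Fin (J + 1)) ℝ).sum_repr v]
  simp [mulVec, dotProduct, constraintMatrix, mul_comm]

lemma surjective_fderiv_of_rank {m : Param J → EuclideanSpace ℝ (Fin r)} {θ : Param J}
    (h : (constraintMatrix m θ).rank = r) : Function.Surjective (fderiv ℝ m θ) := by
  have hr : LinearMap.range (constraintMatrix m θ)ᵀ.mulVecLin = ⊤ := by
    refine Submodule.eq_top_of_finrank_eq ?_
    change (constraintMatrix m θ)ᵀ.rank = _
    rw [rank_transpose, h]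
    simp
  intro y
  obtain ⟨v, hv⟩ := LinearMap.range_eq_top.1 hr y
  refine ⟨WithLp.toLp 2 v, ?_⟩
  ext s
  rw [← constraintMatrix_transpose_mulVec]
  exact congrFun hv s

lemma injective_constraintMatrix_mulVec {m : Param J → EuclideanSpace ℝ (Fin r)} {θ : Param J}
    (h : Function.Surjective (fderiv ℝ m θ)) :
    Function.Injective (constraintMatrix m θ).mulVec := by
  refine (injective_iff_map_eq_zero (constraintMatrix m θ).mulVecLin).2 fun lam hl => ?_
  obtain ⟨v, hv⟩ := h (WithLp.toLp 2 lam)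
  have h1 : lam = (constraintMatrix m θ)ᵀ *ᵥ v := by
    rw [constraintMatrix_transpose_mulVec, hv]
  have h2 : lam ⬝ᵥ lam = 0 := by
    have h3 : constraintMatrix m θ *ᵥ lam = 0 := hl
    nth_rewrite 1 [h1]
    rw [mulVec_transpose, ← dotProduct_mulVec, h3, dotProduct_zero]
  exact dotProduct_self_eq_zero.1 h2

/-- The matrix `A` as an operator on linear forms. -/
def dualOp (A : Matrix (Fin (J + 1) ⊕ Fin (J + 1)) (Fin (J + 1) ⊕ Fin (J + 1)) ℝ) :
    (Param J →L[ℝ] ℝ) →L[ℝ] Param J :=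
  LinearMap.toContinuousLinearMap
    { toFun := fun Λ => WithLp.toLp 2 (A *ᵥ fun q => Λ (EuclideanSpace.single q 1))
      map_add' := fun Λ Λ' => by
        rw [← WithLp.toLp_add, ← mulVec_add]; rfl
      map_smul' := fun c Λ => by
        rw [RingHom.id_apply, ← WithLp.toLp_smul, ← mulVec_smul]; rfl }

lemma dualOp_apply (A : Matrix (Fin (J + 1) ⊕ Fin (J + 1)) (Fin (J + 1) ⊕ Fin (J + 1)) ℝ)
    (Λ : Param J →L[ℝ] ℝ) :
    dualOp A Λ = WithLp.toLp 2 (A *ᵥ fun q => Λ (EuclideanSpace.single q 1)) := rfl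

lemma dualOp_fderiv_logit
    (A : Matrix (Fin (J + 1) ⊕ Fin (J + 1)) (Fin (J + 1) ⊕ Fin (J + 1)) ℝ)
    (D : Design I J) (i : Fin I) (θ : Param J) :
    dualOp A (fderiv ℝ (logit D i) θ) = WithLp.toLp 2 (A *ᵥ logitGrad D i θ) := by
  rw [dualOp_apply]
  congr 2
  funext q
  simp [fderiv_logit]

lemma asympCov_eq (D : Design I J) (m : Param J → EuclideanSpace ℝ (Fin r)) (w : Fin I → ℝ)
    (θ : Param J) :
    asympCov D m w θ = restrictedCov (fisherInfo D w θ) (constraintMatrix m θ) := rfl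

lemma posSemidef_asympCov {D : Design I J} {m : Param J → EuclideanSpace ℝ (Fin r)}
    {w : Fin I → ℝ} {θ : Param J} (hI : (fisherInfo D w θ).PosDef)
    (hM : Function.Injective (constraintMatrix m θ).mulVec) : (asympCov D m w θ).PosSemidef :=
  posSemidef_restrictedCov hI hM

lemma dualOp_asympCov_comp {D : Design I J} {m : Param J → EuclideanSpace ℝ (Fin r)}
    {w : Fin I → ℝ} {θ : Param J} (hI : (fisherInfo D w θ).PosDef)
    (hM : Function.Injective (constraintMatrix m θ).mulVec)
    (Λ : EuclideanSpace ℝ (Fin r) →L[ℝ] ℝ) :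
    dualOp (asympCov D m w θ) (Λ.comp (fderiv ℝ m θ)) = 0 := by
  have h : (fun q => (Λ.comp (fderiv ℝ m θ)) (EuclideanSpace.single q 1)) =
      constraintMatrix m θ *ᵥ fun s => Λ (EuclideanSpace.single s 1) := by
    funext q
    rw [ContinuousLinearMap.comp_apply]
    conv_lhs => rw [← (EuclideanSpace.basisFun (Fin r) ℝ).sum_repr
      (fderiv ℝ m θ (EuclideanSpace.single q 1))]
    simp [mulVec, dotProduct, constraintMatrix]
  rw [dualOp_apply, h, mulVec_mulVec, asympCov_eq, restrictedCov_mul_constraint hI hM,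
    zero_mulVec, WithLp.toLp_zero]

lemma dualOp_info (A : Matrix (Fin (J + 1) ⊕ Fin (J + 1)) (Fin (J + 1) ⊕ Fin (J + 1)) ℝ)
    (D : Design I J) (w : Fin I → ℝ) (θ v : Param J) :
    dualOp A (info (logit D) w θ v) = WithLp.toLp 2 ((A * fisherInfo D w θ) *ᵥ v) := by
  rw [← mulVec_mulVec, fisherInfo_mulVec, dualOp_apply]
  congr 2
  funext q
  simp only [info, _root_.sum_apply, Finset.sum_apply]
  refine Finset.sum_congr rfl fun i _ => ?_
  simp [fderiv_logit, mul_assoc]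

lemma exists_dualOp_asympCov_info {D : Design I J} (m : Param J → EuclideanSpace ℝ (Fin r))
    {w : Fin I → ℝ} {θ : Param J} (hI : (fisherInfo D w θ).PosDef) :
    ∃ Q : EuclideanSpace ℝ (Fin r) →L[ℝ] Param J, ∀ v,
      dualOp (asympCov D m w θ) (info (logit D) w θ v) = v - Q (fderiv ℝ m θ v) := by
  refine ⟨LinearMap.toContinuousLinearMap (toLpLin 2 2 ((fisherInfo D w θ)⁻¹ *
    constraintMatrix m θ * ((constraintMatrix m θ)ᵀ * (fisherInfo D w θ)⁻¹ *
      constraintMatrix m θ)⁻¹)), fun v => ?_⟩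
  rw [dualOp_info, asympCov_eq, restrictedCov_mul hI, sub_mulVec, one_mulVec, ← mulVec_mulVec,
    constraintMatrix_transpose_mulVec]
  rfl

lemma sum_inner_sq_eq {D : Design I J} {m : Param J → EuclideanSpace ℝ (Fin r)}
    {w : Fin I → ℝ} {θ : Param J} (hI : (fisherInfo D w θ).PosDef)
    (hM : Function.Injective (constraintMatrix m θ).mulVec) (t : Param J) :
    ∑ i, w i * (Real.sigmoid (logit D i θ) * (1 - Real.sigmoid (logit D i θ))) *
      inner ℝ (dualOp (asympCov D m w θ) (fderiv ℝ (logit D i) θ)) t ^ 2 =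
      t ⬝ᵥ asympCov D m w θ *ᵥ t := by
  have hS : (asympCov D m w θ)ᵀ = asympCov D m w θ := transpose_restrictedCov hI
  have h1 : ∀ i, inner ℝ (dualOp (asympCov D m w θ) (fderiv ℝ (logit D i) θ)) t =
      logitGrad D i θ ⬝ᵥ (asympCov D m w θ *ᵥ t) := fun i => by
    rw [dualOp_fderiv_logit, EuclideanSpace.inner_eq_star_dotProduct, star_trivial,
      dotProduct_mulVec, ← mulVec_transpose, hS, dotProduct_comm]
  have h2 : t ⬝ᵥ asympCov D m w θ *ᵥ t =
      (asympCov D m w θ *ᵥ t) ⬝ᵥ (fisherInfo D w θ *ᵥ (asympCov D m w θ *ᵥ t)) := by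
    conv_lhs => rw [asympCov_eq, ← restrictedCov_mul_mul_transpose hI hM, ← asympCov_eq, hS]
    rw [← mulVec_mulVec, ← mulVec_mulVec, dotProduct_mulVec, ← mulVec_transpose, hS]
  rw [h2, fisherInfo_eq, Matrix.sum_mulVec, dotProduct_sum]
  refine Finset.sum_congr rfl fun i _ => ?_
  rw [h1, smul_mulVec, vecMulVec_mulVec, dotProduct_smul]
  simp [dotProduct_comm (asympCov D m w θ *ᵥ t), sq]

end OneShot

end

noncomputable section

/-! ### Events whose probability tends to one -/

section WithHighProb

variable {Ω : Type*} [MeasurableSpace Ω]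

/-- The events `A N` have probability tending to one. -/
def WithHighProb (P : Measure Ω) (A : ℕ → Set Ω) : Prop :=
  Tendsto (fun N => P (A N)ᶜ) atTop (𝓝 0)

variable {P : Measure Ω} {A B : ℕ → Set Ω}

lemma WithHighProb.mono (h : WithHighProb P A) (hAB : ∀ᶠ N in atTop, A N ⊆ B N) :
    WithHighProb P B :=
  tendsto_of_tendsto_of_tendsto_of_le_of_le' tendsto_const_nhds h
    (Eventually.of_forall fun _ => zero_le) (hAB.mono fun _ hN =>
      measure_mono (Set.compl_subset_compl.2 hN))

lemma WithHighProb.inter (hA : WithHighProb P A) (hB : WithHighProb P B) :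
    WithHighProb P fun N => A N ∩ B N := by
  have h : Tendsto (fun N => P (A N)ᶜ + P (B N)ᶜ) atTop (𝓝 0) := by simpa using hA.add hB
  refine tendsto_of_tendsto_of_tendsto_of_le_of_le tendsto_const_nhds h (fun _ => zero_le)
    fun N => ?_
  simp only [Set.compl_inter]
  exact measure_union_le _ _

lemma WithHighProb.tendsto_one [IsProbabilityMeasure P] (h : WithHighProb P A) :
    Tendsto (fun N => P (A N)) atTop (𝓝 1) := by
  have h1 : Tendsto (fun N => 1 - P (A N)ᶜ) atTop (𝓝 (1 - 0)) :=
    ENNReal.Tendsto.sub tendsto_const_nhds h (Or.inl ENNReal.one_ne_top)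
  rw [tsub_zero] at h1
  refine tendsto_of_tendsto_of_tendsto_of_le_of_le h1 tendsto_const_nhds (fun N => ?_)
    fun N => prob_le_one
  refine tsub_le_iff_right.2 ?_
  have := measure_union_le (μ := P) (A N) (A N)ᶜ
  rwa [Set.union_compl_self, measure_univ] at this

lemma withHighProb_of_tendsto_one [IsProbabilityMeasure P] (hA : ∀ N, MeasurableSet (A N))
    (h : Tendsto (fun N => P (A N)) atTop (𝓝 1)) : WithHighProb P A := by
  have h1 : Tendsto (fun N => 1 - P (A N)) atTop (𝓝 (1 - 1)) :=
    ENNReal.Tendsto.sub tendsto_const_nhds h (Or.inl ENNReal.one_ne_top)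
  rw [tsub_self] at h1
  exact h1.congr fun N => (prob_compl_eq_one_sub (hA N)).symm

lemma tendstoInMeasure_const_iff {E : Type*} [PseudoMetricSpace E] {f : ℕ → Ω → E} {a : E} :
    TendstoInMeasure P f atTop (fun _ => a) ↔
      ∀ U ∈ 𝓝 a, WithHighProb P fun N => {ω | f N ω ∈ U} := by
  rw [tendstoInMeasure_iff_dist]
  constructor
  · intro h U hU
    obtain ⟨ε, hε, hεU⟩ := Metric.mem_nhds_iff.1 hU
    have h1 : WithHighProb P fun N => {ω | f N ω ∈ Metric.ball a ε} :=
      (h ε hε).congr fun N => by congr 1; ext ω; simp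
    exact h1.mono (Eventually.of_forall fun N ω hω => hεU hω)
  · intro h ε hε
    exact (h _ (Metric.ball_mem_nhds a hε)).congr fun N => by congr 1; ext ω; simp

lemma tendsto_measure_zero_of_forall_exists
    (h : ∀ κ : ENNReal, 0 < κ → ∃ B : ℕ → Set Ω, WithHighProb P B ∧ ∀ N, P (A N ∩ B N) ≤ κ) :
    Tendsto (fun N => P (A N)) atTop (𝓝 0) := by
  refine ENNReal.tendsto_nhds_zero.2 fun κ hκ => ?_
  have hκ2 : 0 < κ / 2 := ENNReal.half_pos hκ.ne'
  obtain ⟨B, hB, hAB⟩ := h (κ / 2) hκ2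
  filter_upwards [ENNReal.tendsto_nhds_zero.1 hB (κ / 2) hκ2] with N hN
  calc P (A N) ≤ P ((A N ∩ B N) ∪ (B N)ᶜ) := measure_mono fun ω hω => by
        by_cases h : ω ∈ B N
        · exact Or.inl ⟨hω, h⟩
        · exact Or.inr h
    _ ≤ κ / 2 + κ / 2 := (measure_union_le _ _).trans (add_le_add (hAB N) hN)
    _ = κ := ENNReal.add_halves κ

end WithHighProb

/-! ### Characteristic functions of centred Bernoulli sums -/

section Bernoulli

open Complex Asymptotics

lemma tendsto_one_add_pow_of_tendsto_mul {c : ℕ → ℕ} {g : ℕ → ℂ} {t : ℂ}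
    (hg : Tendsto g atTop (𝓝 0)) (h : Tendsto (fun N => (c N : ℂ) * g N) atTop (𝓝 t)) :
    Tendsto (fun N => (1 + g N) ^ c N) atTop (𝓝 (exp t)) := by
  have hlog : (fun z : ℂ => log (1 + z) - z) =o[𝓝 0] fun z => z := by
    have := ((hasDerivAt_id (0 : ℂ)).const_add 1).clog (by simp)
    simpa using this.isLittleO
  have h1 : (fun N => (c N : ℂ) * (log (1 + g N) - g N)) =o[atTop] fun _ => (1 : ℂ) :=
    ((isBigO_refl (fun N => (c N : ℂ)) atTop).mul_isLittleO (hlog.comp_tendsto hg)).trans_isBigO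
      (h.isBigO_one ℂ)
  have h2 : Tendsto (fun N => (c N : ℂ) * log (1 + g N)) atTop (𝓝 t) := by
    have := ((isLittleO_one_iff ℂ).1 h1).add h
    rw [zero_add] at this
    exact this.congr fun N => by ring
  refine ((continuous_exp.tendsto t).comp h2).congr' ?_
  have hne : ∀ᶠ N in atTop, 1 + g N ≠ 0 := by
    have : Tendsto (fun N => 1 + g N) atTop (𝓝 1) := by simpa using hg.const_add 1
    exact this.eventually_ne one_ne_zero
  filter_upwards [hne] with N hN
  simp [exp_nat_mul, exp_log hN]

/-- The characteristic function of a centred Bernoulli variable with mean `p`. -/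
def bernoulliCharFun (p u : ℝ) : ℂ :=
  p * exp (u * (1 - p) * I) + (1 - p) * exp (-(u * p) * I)

lemma bernoulliCharFun_isLittleO (p : ℝ) :
    (fun u : ℝ => bernoulliCharFun p u - 1 + p * (1 - p) / 2 * (u : ℂ) ^ 2)
      =o[𝓝 0] fun u => u ^ 2 := by
  have key : ∀ a : ℝ, (fun u : ℝ => exp (u * a * I) - (1 + u * a * I - a ^ 2 / 2 * (u : ℂ) ^ 2))
      =o[𝓝 0] fun u => u ^ 2 := by
    intro a
    have h0 : Tendsto (fun u : ℝ => (u : ℂ) * a * I) (𝓝 0) (𝓝 0) := by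
      have : Continuous fun u : ℝ => (u : ℂ) * a * I := by fun_prop
      simpa using this.tendsto 0
    have h1 := (Complex.exp_sub_sum_range_isBigO_pow 3).comp_tendsto h0
    have h2 : (fun u : ℝ => ((u : ℂ) * a * I) ^ 3) =O[𝓝 0] fun u : ℝ => u ^ 3 := by
      refine IsBigO.of_bound (|a| ^ 3) (Eventually.of_forall fun u => ?_)
      simp [mul_pow, mul_comm]
    refine ((h1.trans h2).trans_isLittleO
      (isLittleO_pow_pow (by norm_num : 2 < 3))).congr_left fun u => ?_
    simp only [Function.comp_apply, Finset.sum_range_succ, Finset.sum_range_zero]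
    simp [Nat.factorial, mul_pow]
    ring
  have h := ((key (1 - p)).const_mul_left (p : ℂ)).add
    ((key (-p)).const_mul_left ((1 - p : ℝ) : ℂ))
  refine h.congr_left fun u => ?_
  simp only [bernoulliCharFun]
  push_cast
  ring_nf

lemma tendsto_bernoulliCharFun_pow {p s w : ℝ} {c : ℕ → ℕ} {K : ℕ → ℕ}
    (hK : Tendsto K atTop atTop) (hw : Tendsto (fun N => (c N : ℝ) / K N) atTop (𝓝 w)) :
    Tendsto (fun N => bernoulliCharFun p ((√(K N))⁻¹ * s) ^ c N) atTop
      (𝓝 (exp (-(w * (p * (1 - p)) * s ^ 2) / 2))) := by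
  have hu : Tendsto (fun N => (√(K N : ℝ))⁻¹ * s) atTop (𝓝 0) := by
    have := (tendsto_inv_atTop_zero.comp (Real.tendsto_sqrt_atTop.comp
      (tendsto_natCast_atTop_atTop.comp hK))).mul_const s
    simpa using this
  have hsq : ∀ N, ((√(K N : ℝ))⁻¹ * s) ^ 2 = s ^ 2 / K N := fun N => by
    rw [mul_pow, inv_pow, Real.sq_sqrt (Nat.cast_nonneg _)]; ring
  have hcu : Tendsto (fun N => (c N : ℝ) * ((√(K N : ℝ))⁻¹ * s) ^ 2) atTop (𝓝 (w * s ^ 2)) :=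
    (hw.mul_const (s ^ 2)).congr fun N => by rw [hsq]; ring
  have hcu' : Tendsto (fun N => (c N : ℂ) * (((√(K N : ℝ))⁻¹ * s : ℝ) : ℂ) ^ 2) atTop
      (𝓝 ((w * s ^ 2 : ℝ) : ℂ)) := by
    have := (Complex.continuous_ofReal.tendsto (w * s ^ 2)).comp hcu
    refine this.congr fun N => ?_
    simp
  have hsmall : Tendsto (fun N => (c N : ℂ) * (bernoulliCharFun p ((√(K N : ℝ))⁻¹ * s) - 1 +
      p * (1 - p) / 2 * (((√(K N : ℝ))⁻¹ * s : ℝ) : ℂ) ^ 2)) atTop (𝓝 0) := by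
    have h1 := (bernoulliCharFun_isLittleO p).comp_tendsto hu
    have h2 : (fun N => (c N : ℂ)) =O[atTop] fun N => (c N : ℝ) :=
      IsBigO.of_bound 1 (Eventually.of_forall fun N => by simp)
    exact (isLittleO_one_iff ℝ).1 ((h2.mul_isLittleO h1).trans_isBigO (hcu.isBigO_one ℝ))
  have hg : Tendsto (fun N => (c N : ℂ) * (bernoulliCharFun p ((√(K N : ℝ))⁻¹ * s) - 1)) atTop
      (𝓝 (-(w * (p * (1 - p)) * s ^ 2) / 2)) := by
    have := hsmall.sub (hcu'.const_mul ((p : ℂ) * (1 - p) / 2))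
    rw [show (0 : ℂ) - (p : ℂ) * (1 - p) / 2 * ((w * s ^ 2 : ℝ) : ℂ) =
      -(w * (p * (1 - p)) * s ^ 2) / 2 by push_cast; ring] at this
    exact this.congr fun N => by ring
  have hg0 : Tendsto (fun N => bernoulliCharFun p ((√(K N : ℝ))⁻¹ * s) - 1) atTop (𝓝 0) := by
    have hc : Continuous fun u : ℝ => bernoulliCharFun p u - 1 := by
      unfold bernoulliCharFun; fun_prop
    have := (hc.tendsto 0).comp hu
    rwa [show bernoulliCharFun p 0 - 1 = 0 by simp [bernoulliCharFun]] at this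
  simpa using tendsto_one_add_pow_of_tendsto_mul hg0 hg

variable {Ω : Type*} [MeasurableSpace Ω] {P : Measure Ω} [IsProbabilityMeasure P]

/-- The centred indicator of the set `A`. -/
def centredIndicator (A : Set Ω) (p : ℝ) (ω : Ω) : ℝ := A.indicator 1 ω - p

lemma measurable_centredIndicator {A : Set Ω} (hA : MeasurableSet A) (p : ℝ) :
    Measurable (centredIndicator A p) :=
  (measurable_one.indicator hA).sub_const p

lemma integral_comp_centredIndicator {G : Type*} [NormedAddCommGroup G] [NormedSpace ℝ G]
    [CompleteSpace G] {A : Set Ω} (hA : MeasurableSet A) {p : ℝ} (hp : P.real A = p) (f : ℝ → G) :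
    ∫ ω, f (centredIndicator A p ω) ∂P = p • f (1 - p) + (1 - p) • f (-p) := by
  have h : ∀ ω, f (centredIndicator A p ω) =
      A.indicator (fun _ => f (1 - p) - f (-p)) ω + f (-p) := fun ω => by
    by_cases hω : ω ∈ A <;> simp [centredIndicator, hω]
  simp_rw [h]
  rw [integral_add ((integrable_const _).indicator hA) (integrable_const _),
    integral_indicator_const _ hA, hp]
  simp [sub_smul, smul_sub]
  abel

lemma charFun_map_centredIndicator_smul {E : Type*} [NormedAddCommGroup E]
    [InnerProductSpace ℝ E] [MeasurableSpace E] [BorelSpace E] [SecondCountableTopology E]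
    {A : Set Ω} (hA : MeasurableSet A) {p : ℝ} (hp : P.real A = p) (v t : E) :
    charFun (P.map fun ω => centredIndicator A p ω • v) t =
      bernoulliCharFun p (inner ℝ v t) := by
  have hm := measurable_centredIndicator hA p
  rw [charFun_apply, integral_map (by fun_prop) (by fun_prop),
    integral_comp_centredIndicator hA hp fun x => exp (inner ℝ (x • v) t * I)]
  simp only [bernoulliCharFun, real_inner_smul_left, real_smul]
  push_cast
  ring_nf

end Bernoulli

end

noncomputable section

/-! ### Asymptotics of the failure counts -/

namespace OneShot

open BinomialLogit

variable {I J r : ℕ} {Ω : Type*}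

lemma failures_le (D : Design I J) (T : Fin I → ℕ → Ω → ℝ) (Ks : Fin I → ℕ) (ω : Ω) (i : Fin I) :
    failures D T Ks ω i ≤ Ks i :=
  (Finset.card_filter_le _ _).trans (Finset.card_range _).le

lemma failures_sub_eq_sum (D : Design I J) (T : Fin I → ℕ → Ω → ℝ) (Ks : Fin I → ℕ) (ω : Ω)
    (i : Fin I) (p : ℝ) : (failures D T Ks ω i : ℝ) - Ks i * p =
      ∑ k ∈ Finset.range (Ks i), centredIndicator {ω | T i k ω ≤ D.τ i} p ω := by
  rw [failures, Finset.card_filter]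
  push_cast
  simp [centredIndicator, Set.indicator_apply]

variable [MeasurableSpace Ω]

lemma measurable_failures {D : Design I J} {T : Fin I → ℕ → Ω → ℝ}
    (hT : ∀ i k, Measurable (T i k)) (Ks : Fin I → ℕ) : Measurable (failures D T Ks) := by
  refine measurable_pi_lambda _ fun i => ?_
  simp only [failures, Finset.card_filter]
  exact Finset.measurable_sum _ fun k _ => Measurable.ite
    (measurableSet_le (hT i k) measurable_const) measurable_const measurable_const

variable {P : Measure Ω} {D : Design I J} {θ₀ : Param J}
  {T : Fin I → ℕ → Ω → ℝ}

lemma measureReal_failure (hTlaw : ∀ i k, IsLogLogistic P (T i k) (scale D θ₀ i) (shape D θ₀ i))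
    (i : Fin I) (k : ℕ) :
    P.real {ω | T i k ω ≤ D.τ i} = Real.sigmoid (logit D i θ₀) := by
  rw [hTlaw i k, ← failProb_eq]; rfl

lemma iIndepFun_centredIndicator (hTindep : iIndepFun (fun q : Fin I × ℕ => T q.1 q.2) P)
    {E : Type*} [NormedAddCommGroup E] [NormedSpace ℝ E] [MeasurableSpace E] [BorelSpace E]
    (p : Fin I → ℝ) (v : Fin I → E) :
    iIndepFun (fun (q : Fin I × ℕ) ω =>
      centredIndicator {ω | T q.1 q.2 ω ≤ D.τ q.1} (p q.1) ω • v q.1) P := by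
  refine hTindep.comp
    (fun q x => centredIndicator {x | x ≤ D.τ q.1} (p q.1) x • v q.1) fun q => ?_
  exact (measurable_centredIndicator measurableSet_Iic (p q.1)).smul_const (v q.1)

variable {Ks : ℕ → Fin I → ℕ} {w : Fin I → ℝ}

/-- The normalised sum of the centred failure counts with weights `v`. -/
def failureSum {E : Type*} [NormedAddCommGroup E] [NormedSpace ℝ E] (D : Design I J)
    (θ₀ : Param J) (T : Fin I → ℕ → Ω → ℝ) (Ks : Fin I → ℕ) (v : Fin I → E) (ω : Ω) : E :=
  (√(total Ks : ℝ))⁻¹ •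
    ∑ i, ((failures D T Ks ω i : ℝ) - Ks i * Real.sigmoid (logit D i θ₀)) • v i

lemma measurable_failureSum {E : Type*} [NormedAddCommGroup E] [NormedSpace ℝ E]
    [MeasurableSpace E] [BorelSpace E] [SecondCountableTopology E]
    (hT : ∀ i k, Measurable (T i k)) (Ks : Fin I → ℕ) (v : Fin I → E) :
    Measurable (failureSum D θ₀ T Ks v) := by
  have h : Measurable fun n : Fin I → ℕ => (√(total Ks : ℝ))⁻¹ •
    ∑ i, ((n i : ℝ) - Ks i * Real.sigmoid (logit D i θ₀)) • v i := measurable_of_countable _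
  exact h.comp (measurable_failures hT Ks)

/-- The indices of the devices under test. -/
def indexPairs (c : Fin I → ℕ) : Finset (Fin I × ℕ) :=
  Finset.univ.biUnion fun i => (Finset.range (c i)).map ⟨Prod.mk i, Prod.mk_right_injective i⟩

@[to_additive]
lemma prod_indexPairs {G : Type*} [CommMonoid G] (c : Fin I → ℕ) (f : Fin I × ℕ → G) :
    ∏ q ∈ indexPairs c, f q = ∏ i, ∏ k ∈ Finset.range (c i), f (i, k) := by
  rw [indexPairs, Finset.prod_biUnion]
  · simp
  · intro i _ j _ hij
    simp only [Function.onFun, Finset.disjoint_left, Finset.mem_map, not_exists, not_and]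
    rintro q ⟨k, -, rfl⟩ l - h
    exact hij (congrArg Prod.fst h).symm

lemma charFun_failureSum [IsProbabilityMeasure P] {E : Type*} [NormedAddCommGroup E] [InnerProductSpace ℝ E]
    [MeasurableSpace E] [BorelSpace E] [SecondCountableTopology E]
    (hT : ∀ i k, Measurable (T i k)) (hTindep : iIndepFun (fun q : Fin I × ℕ => T q.1 q.2) P)
    (hTlaw : ∀ i k, IsLogLogistic P (T i k) (scale D θ₀ i) (shape D θ₀ i))
    (Ks : Fin I → ℕ) (v : Fin I → E) (t : E) :
    charFun (P.map (failureSum D θ₀ T Ks v)) t =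
      ∏ i, bernoulliCharFun (Real.sigmoid (logit D i θ₀))
        ((√(total Ks : ℝ))⁻¹ * inner ℝ (v i) t) ^ Ks i := by
  have hind := iIndepFun_centredIndicator (D := D) hTindep
    (fun i => Real.sigmoid (logit D i θ₀)) fun i => (√(total Ks : ℝ))⁻¹ • v i
  have hA : ∀ i k, MeasurableSet {ω | T i k ω ≤ D.τ i} := fun i k =>
    measurableSet_le (hT i k) measurable_const
  have h1 : failureSum D θ₀ T Ks v = fun ω => ∑ q ∈ indexPairs Ks,
      centredIndicator {ω | T q.1 q.2 ω ≤ D.τ q.1} (Real.sigmoid (logit D q.1 θ₀)) ω •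
        (√(total Ks : ℝ))⁻¹ • v q.1 := by
    funext ω
    rw [sum_indexPairs]
    simp only [failureSum, failures_sub_eq_sum, Finset.smul_sum, Finset.sum_smul]
    refine Finset.sum_congr rfl fun i _ => Finset.sum_congr rfl fun k _ => ?_
    rw [smul_comm]
  rw [h1, (hind.restrict (indexPairs Ks)).charFun_map_fun_finsetSum_eq_prod fun q _ =>
    ((measurable_centredIndicator (hA q.1 q.2) _).smul_const _).aemeasurable,
    Finset.prod_apply, prod_indexPairs]
  refine Finset.prod_congr rfl fun i _ => ?_
  rw [Finset.prod_congr rfl fun k _ => charFun_map_centredIndicator_smul (hA i k)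
    (measureReal_failure hTlaw i k) _ t]
  simp [real_inner_smul_left]

lemma variance_failures_le [IsProbabilityMeasure P] (hT : ∀ i k, Measurable (T i k))
    (hTindep : iIndepFun (fun q : Fin I × ℕ => T q.1 q.2) P)
    (hTlaw : ∀ i k, IsLogLogistic P (T i k) (scale D θ₀ i) (shape D θ₀ i))
    (Ks : Fin I → ℕ) (i : Fin I) :
    MemLp (fun ω => (failures D T Ks ω i : ℝ) - Ks i * Real.sigmoid (logit D i θ₀)) 2 P ∧
    ∫ ω, ((failures D T Ks ω i : ℝ) - Ks i * Real.sigmoid (logit D i θ₀)) ∂P = 0 ∧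
    Var[fun ω => (failures D T Ks ω i : ℝ) - Ks i * Real.sigmoid (logit D i θ₀); P] ≤ Ks i := by
  set p := Real.sigmoid (logit D i θ₀) with hp
  have hp0 : 0 ≤ p := Real.sigmoid_nonneg _
  have hp1 : p ≤ 1 := Real.sigmoid_le_one _
  set Y : ℕ → Ω → ℝ := fun k => centredIndicator {ω | T i k ω ≤ D.τ i} p with hY
  have hA : ∀ k, MeasurableSet {ω | T i k ω ≤ D.τ i} := fun k =>
    measurableSet_le (hT i k) measurable_const
  have hYm : ∀ k, Measurable (Y k) := fun k => measurable_centredIndicator (hA k) p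
  have hYb : ∀ k ω, Y k ω ∈ Set.Icc (-1 : ℝ) 1 := fun k ω => by
    by_cases h : T i k ω ≤ D.τ i <;> simp [hY, centredIndicator, h] <;> constructor <;> linarith
  have hL : ∀ k, MemLp (Y k) 2 P := fun k =>
    MemLp.of_bound (hYm k).aestronglyMeasurable 1 (ae_of_all _ fun ω => abs_le.2 (hYb k ω))
  have hsum : (fun ω => (failures D T Ks ω i : ℝ) - Ks i * p) =
      ∑ k ∈ Finset.range (Ks i), Y k := by
    funext ω
    rw [failures_sub_eq_sum, Finset.sum_apply]
  have hint : ∀ k, ∫ ω, Y k ω ∂P = 0 := fun k => by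
    have := integral_comp_centredIndicator (hA k) (measureReal_failure hTlaw i k) fun x : ℝ => x
    rw [← hp] at this
    rw [this]
    simp only [smul_eq_mul]
    ring
  refine ⟨?_, ?_, ?_⟩
  · rw [hsum]; exact memLp_finsetSum' _ fun k _ => hL k
  · simp_rw [failures_sub_eq_sum]
    rw [integral_finsetSum _ fun k _ => (hL k).integrable one_le_two]
    simp [hint]
  · have hind : iIndepFun (fun k => T i k) P :=
      hTindep.precomp (g := fun k : ℕ => (i, k)) (Prod.mk_right_injective i)
    have hYind : iIndepFun Y P := hind.comp (fun _ x => centredIndicator {x | x ≤ D.τ i} p x)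
      fun _ => measurable_centredIndicator measurableSet_Iic p
    rw [hsum, IndepFun.variance_sum (fun k _ => hL k) fun k _ l _ hkl => hYind.indepFun hkl]
    calc ∑ k ∈ Finset.range (Ks i), Var[Y k; P] ≤ ∑ k ∈ Finset.range (Ks i), (1 : ℝ) := by
          refine Finset.sum_le_sum fun k _ => ?_
          have := variance_le_sq_of_bounded (ae_of_all P (hYb k)) (hYm k).aemeasurable
          norm_num at this
          exact this
      _ = Ks i := by simp

lemma measure_le_abs_failures [IsProbabilityMeasure P] (hT : ∀ i k, Measurable (T i k))
    (hTindep : iIndepFun (fun q : Fin I × ℕ => T q.1 q.2) P)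
    (hTlaw : ∀ i k, IsLogLogistic P (T i k) (scale D θ₀ i) (shape D θ₀ i))
    (Ks : Fin I → ℕ) (hK : 0 < total Ks) (i : Fin I) {R : ℝ} (hR : 0 < R) :
    P {ω | R ≤ (√(total Ks : ℝ))⁻¹ *
      |(failures D T Ks ω i : ℝ) - Ks i * Real.sigmoid (logit D i θ₀)|} ≤
      ENNReal.ofReal (1 / R ^ 2) := by
  obtain ⟨hL, hint, hvar⟩ := variance_failures_le hT hTindep hTlaw Ks i
  have hK' : (0 : ℝ) < total Ks := Nat.cast_pos.2 hK
  have hs : 0 < √(total Ks : ℝ) := Real.sqrt_pos.2 hK'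
  have h := meas_ge_le_variance_div_sq hL (mul_pos hR hs)
  rw [hint] at h
  simp only [sub_zero] at h
  have hset : {ω | R ≤ (√(total Ks : ℝ))⁻¹ *
      |(failures D T Ks ω i : ℝ) - Ks i * Real.sigmoid (logit D i θ₀)|} =
      {ω | R * √(total Ks : ℝ) ≤
        |(failures D T Ks ω i : ℝ) - Ks i * Real.sigmoid (logit D i θ₀)|} := by
    ext ω
    simp only [Set.mem_ofPred_eq]
    rw [inv_mul_eq_div, le_div_iff₀ hs]
  rw [hset]
  refine h.trans (ENNReal.ofReal_le_ofReal ?_)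
  have hKi : (Ks i : ℝ) ≤ total Ks := by
    exact_mod_cast Finset.single_le_sum (f := Ks) (fun _ _ => Nat.zero_le _) (Finset.mem_univ i)
  rw [mul_pow, Real.sq_sqrt hK'.le, div_le_div_iff₀ (by positivity) (by positivity)]
  have := mul_le_mul_of_nonneg_right (hvar.trans hKi) (sq_nonneg R)
  linarith

/-- The normalised centred failure counts are bounded in probability. -/
lemma exists_bound_failures [IsProbabilityMeasure P] (hT : ∀ i k, Measurable (T i k))
    (hTindep : iIndepFun (fun q : Fin I × ℕ => T q.1 q.2) P)
    (hTlaw : ∀ i k, IsLogLogistic P (T i k) (scale D θ₀ i) (shape D θ₀ i))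
    {κ : ENNReal} (hκ : 0 < κ) :
    ∃ R : ℝ, 0 < R ∧ ∀ Ks : Fin I → ℕ, 0 < total Ks →
      P {ω | ∃ i, R ≤ (√(total Ks : ℝ))⁻¹ *
        |(failures D T Ks ω i : ℝ) - Ks i * Real.sigmoid (logit D i θ₀)|} ≤ κ := by
  have h : Tendsto (fun R : ℝ => (I : ENNReal) * ENNReal.ofReal (1 / R ^ 2)) atTop (𝓝 0) := by
    have h1 : Tendsto (fun R : ℝ => 1 / R ^ 2) atTop (𝓝 0) := by
      simp only [one_div]
      exact tendsto_inv_atTop_zero.comp (tendsto_pow_atTop two_ne_zero)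
    have h2 := ENNReal.Tendsto.const_mul (ENNReal.tendsto_ofReal h1)
      (Or.inr (ENNReal.natCast_ne_top I))
    simpa using h2
  obtain ⟨R, hR, hR0⟩ :=
    ((ENNReal.tendsto_nhds_zero.1 h κ hκ).and (eventually_gt_atTop (0 : ℝ))).exists
  refine ⟨R, hR0, fun Ks hK => ?_⟩
  rw [Set.ofPred_exists]
  refine (measure_iUnion_fintype_le _ _).trans ?_
  refine (Finset.sum_le_sum fun i _ =>
    measure_le_abs_failures hT hTindep hTlaw Ks hK i hR0).trans ?_
  simpa using hR

/-- The group proportions together with the failure proportions. -/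
def proportions (Ks n : Fin I → ℕ) : (Fin I → ℝ) × (Fin I → ℝ) :=
  (fun i => (Ks i : ℝ) / total Ks, fun i => (n i : ℝ) / total Ks)

lemma withHighProb_total_pos (hK : Tendsto (fun N => total (Ks N)) atTop atTop) :
    WithHighProb P fun N => {_ω : Ω | 0 < total (Ks N)} := by
  have h : WithHighProb P fun _ => (Set.univ : Set Ω) := by simp [WithHighProb]
  exact h.mono ((hK.eventually_gt_atTop 0).mono fun N hN ω _ => hN)

lemma tendstoInMeasure_proportions [IsProbabilityMeasure P] (hT : ∀ i k, Measurable (T i k))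
    (hTindep : iIndepFun (fun q : Fin I × ℕ => T q.1 q.2) P)
    (hTlaw : ∀ i k, IsLogLogistic P (T i k) (scale D θ₀ i) (shape D θ₀ i))
    (hK : Tendsto (fun N => total (Ks N)) atTop atTop)
    (hw : ∀ i, Tendsto (fun N => (Ks N i : ℝ) / (total (Ks N) : ℝ)) atTop (𝓝 (w i))) :
    TendstoInMeasure P (fun N ω => proportions (Ks N) (failures D T (Ks N) ω)) atTop
      fun _ => (w, meanProp (logit D) w θ₀) := by
  have hsqrt : Tendsto (fun N => √(total (Ks N) : ℝ)) atTop atTop :=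
    Real.tendsto_sqrt_atTop.comp (tendsto_natCast_atTop_atTop.comp hK)
  rw [tendstoInMeasure_iff_dist]
  intro ε hε
  refine tendsto_measure_zero_of_forall_exists fun κ hκ => ?_
  obtain ⟨R, hR, hbound⟩ := exists_bound_failures hT hTindep hTlaw hκ
  have hsmall : ∀ᶠ N in atTop, R / √(total (Ks N) : ℝ) < ε / 2 :=
    (tendsto_const_nhds.div_atTop hsqrt).eventually_lt_const (half_pos hε)
  have hdet : ∀ᶠ N in atTop, ∀ i, |(Ks N i : ℝ) / total (Ks N) - w i| < ε / 2 :=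
    eventually_all.2 fun i => by
      simpa [Real.dist_eq] using Metric.tendsto_nhds.1 (hw i) (ε / 2) (half_pos hε)
  have hev := (hsmall.and hdet).and (hK.eventually_gt_atTop 0)
  have huniv : WithHighProb P fun _ => (Set.univ : Set Ω) := by simp [WithHighProb]
  refine ⟨fun N => {ω | (R / √(total (Ks N) : ℝ) < ε / 2 ∧
      ∀ i, |(Ks N i : ℝ) / total (Ks N) - w i| < ε / 2) ∧ 0 < total (Ks N)},
    huniv.mono (hev.mono fun N hN ω _ => hN), fun N => ?_⟩
  by_cases hN : 0 < total (Ks N)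
  · refine (measure_mono ?_).trans (hbound (Ks N) hN)
    rintro ω ⟨hω, ⟨h1, h2⟩, -⟩
    by_contra hcon
    simp only [Set.mem_ofPred_eq, not_exists, not_le] at hcon hω
    refine absurd hω (not_le.2 ?_)
    have hK' : (0 : ℝ) < total (Ks N) := Nat.cast_pos.2 hN
    have hs : 0 < √(total (Ks N) : ℝ) := Real.sqrt_pos.2 hK'
    rw [Prod.dist_eq, max_lt_iff, dist_pi_lt_iff hε, dist_pi_lt_iff hε]
    refine ⟨fun i => ?_, fun i => ?_⟩
    · rw [Real.dist_eq]
      exact (h2 i).trans (by linarith)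
    · set p := Real.sigmoid (logit D i θ₀) with hp
      have hp0 : 0 ≤ p := Real.sigmoid_nonneg _
      have hp1 : p ≤ 1 := Real.sigmoid_le_one _
      have e1 : (failures D T (Ks N) ω i : ℝ) / total (Ks N) - w i * p =
          ((failures D T (Ks N) ω i : ℝ) - Ks N i * p) / total (Ks N) +
            ((Ks N i : ℝ) / total (Ks N) - w i) * p := by ring
      have e2 : |((failures D T (Ks N) ω i : ℝ) - Ks N i * p) / total (Ks N)| < ε / 2 := by
        refine lt_of_le_of_lt ?_ h1
        have := (hcon i).le
        rw [abs_div, abs_of_pos hK', div_le_div_iff₀ hK' hs]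
        rw [inv_mul_eq_div, div_le_iff₀ hs] at this
        calc _ ≤ R * √(total (Ks N) : ℝ) * √(total (Ks N) : ℝ) := by gcongr
          _ = R * total (Ks N) := by rw [mul_assoc, Real.mul_self_sqrt hK'.le]
      have e3 : |((Ks N i : ℝ) / total (Ks N) - w i) * p| < ε / 2 := by
        rw [abs_mul, abs_of_nonneg hp0]
        exact lt_of_le_of_lt (mul_le_of_le_one_right (abs_nonneg _) hp1) (h2 i)
      change dist ((failures D T (Ks N) ω i : ℝ) / total (Ks N)) (w i * p) < ε
      rw [Real.dist_eq, e1]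
      exact (abs_add_le _ _).trans_lt (by linarith)
  · rw [show {ω | _} ∩ _ = (∅ : Set Ω) from Set.eq_empty_of_forall_notMem
      fun ω hω => hN hω.2.2, measure_empty]
    exact zero_le

end OneShot

end

noncomputable section

/-! ### Asymptotic normality of the restricted estimators -/

namespace OneShot

open BinomialLogit

variable {I J r : ℕ} {Ω : Type*} {D : Design I J}
  {m : Param J → EuclideanSpace ℝ (Fin r)} {θ₀ : Param J} {T : Fin I → ℕ → Ω → ℝ}

lemma total_smul_proportions {c n : Fin I → ℕ} (hc : 0 < total c) :
    (fun i => (c i : ℝ)) = (total c : ℝ) • (proportions c n).1 ∧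
    (fun i => (n i : ℝ)) = (total c : ℝ) • (proportions c n).2 := by
  have : (total c : ℝ) ≠ 0 := Nat.cast_ne_zero.2 hc.ne'
  constructor <;> funext i <;> simp [proportions] <;> field_simp

lemma score_proportions (D : Design I J) {c n : Fin I → ℕ} (hc : 0 < total c) (θ : Param J) :
    score (logit D) (fun i => (c i : ℝ)) (fun i => (n i : ℝ)) θ =
      (total c : ℝ) • score (logit D) (proportions c n).1 (proportions c n).2 θ := by
  obtain ⟨h1, h2⟩ := total_smul_proportions (n := n) hc
  rw [h1, h2, score, score, Finset.smul_sum]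
  refine Finset.sum_congr rfl fun i _ => ?_
  simp only [Pi.smul_apply, smul_eq_mul]
  rw [smul_smul]
  ring_nf

lemma logLik_proportions (D : Design I J) {c n : Fin I → ℕ} (hc : 0 < total c) (θ : Param J) :
    logLik (logit D) (fun i => (c i : ℝ)) (fun i => (n i : ℝ)) θ =
      (total c : ℝ) * logLik (logit D) (proportions c n).1 (proportions c n).2 θ := by
  obtain ⟨h1, h2⟩ := total_smul_proportions (n := n) hc
  rw [h1, h2, logLik, logLik, Finset.mul_sum]
  refine Finset.sum_congr rfl fun i _ => ?_
  simp only [Pi.smul_apply, smul_eq_mul]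
  ring

lemma exists_multiplier_proportions {c n : Fin I → ℕ} (hc : 0 < total c) {θ : Param J}
    (h : IsRestrictedRoot D m c n 0 θ) : ∃ Λ : EuclideanSpace ℝ (Fin r) →L[ℝ] ℝ,
      score (logit D) (proportions c n).1 (proportions c n).2 θ + Λ.comp (fderiv ℝ m θ) = 0 := by
  obtain ⟨⟨Λ, hΛ⟩, -⟩ := (isRestrictedRoot_zero_iff D m c n θ).1 h
  have hc' : (total c : ℝ) ≠ 0 := Nat.cast_ne_zero.2 hc.ne'
  refine ⟨(total c : ℝ)⁻¹ • Λ, ?_⟩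
  rw [score_proportions D hc] at hΛ
  rw [ContinuousLinearMap.smul_comp, ← inv_smul_smul₀ hc' (score _ _ _ _), ← smul_add, hΛ,
    smul_zero]

lemma likelihood_le_likelihood_iff {c n : Fin I → ℕ} (hn : ∀ i, n i ≤ c i) {θ θ' : Param J} :
    likelihood D c n θ ≤ likelihood D c n θ' ↔
      logLik (logit D) (fun i => (c i : ℝ)) (fun i => (n i : ℝ)) θ ≤
        logLik (logit D) (fun i => (c i : ℝ)) (fun i => (n i : ℝ)) θ' := by
  rw [likelihood_eq_exp_logLik D hn, likelihood_eq_exp_logLik D hn, Real.exp_le_exp]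

lemma IsRestrictedLocalMLE.isRestrictedRoot {c n : Fin I → ℕ} (hn : ∀ i, n i ≤ c i)
    {θ : Param J} (hm : ContDiffAt ℝ 1 m θ) (hsurj : Function.Surjective (fderiv ℝ m θ))
    (h : IsRestrictedLocalMLE D m c n θ) : IsRestrictedRoot D m c n 0 θ := by
  have hmax : IsLocalMaxOn (logLik (logit D) (fun i => (c i : ℝ)) (fun i => (n i : ℝ)))
      {θ | m θ = 0} θ := h.2.mono fun θ' hθ' => (likelihood_le_likelihood_iff hn).1 hθ'
  exact (isRestrictedRoot_zero_iff D m c n θ).2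
    ⟨exists_multiplier (contDiff_logit D) hm hsurj h.1 hmax, h.1⟩

lemma isRestrictedLocalMLE_of_isLocalMaxOn {c n : Fin I → ℕ} (hn : ∀ i, n i ≤ c i)
    (hc : 0 < total c) {θ : Param J} (hθ : m θ = 0)
    (h : IsLocalMaxOn (logLik (logit D) (proportions c n).1 (proportions c n).2)
      {θ | m θ = 0} θ) : IsRestrictedLocalMLE D m c n θ := by
  refine ⟨hθ, h.mono fun θ' hθ' => ?_⟩
  rw [likelihood_le_likelihood_iff hn, logLik_proportions D hc, logLik_proportions D hc]
  exact mul_le_mul_of_nonneg_left hθ' (Nat.cast_nonneg _)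

lemma IsRestrictedMLE.isRestrictedLocalMLE {c n : Fin I → ℕ} {θ : Param J}
    (h : IsRestrictedMLE D m c n θ) : IsRestrictedLocalMLE D m c n θ :=
  ⟨h.1, h.2.localize⟩

lemma eventually_contDiffAt_surjective (hm : ContDiffAt ℝ 1 m θ₀)
    (hsurj : Function.Surjective (fderiv ℝ m θ₀)) :
    ∀ᶠ θ in 𝓝 θ₀, ContDiffAt ℝ 1 m θ ∧ Function.Surjective (fderiv ℝ m θ) :=
  (hm.eventually (by norm_num)).and
    (eventually_surjective (hm.fderiv_right (m := 0) (by norm_num)).continuousAt.tendsto hsurj)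

lemma score_true (D : Design I J) (c n : Fin I → ℕ) (θ₀ : Param J) :
    score (logit D) (fun i => (c i : ℝ)) (fun i => (n i : ℝ)) θ₀ =
      ∑ i, ((n i : ℝ) - c i * Real.sigmoid (logit D i θ₀)) • fderiv ℝ (logit D i) θ₀ := rfl

lemma sqrt_smul_score_proportions {c : Fin I → ℕ} (hc : 0 < total c) (ω : Ω) :
    √(total c : ℝ) • score (logit D) (proportions c (failures D T c ω)).1
      (proportions c (failures D T c ω)).2 θ₀ =
      failureSum D θ₀ T c (fun i => fderiv ℝ (logit D i) θ₀) ω := by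
  have hc' : (0 : ℝ) < total c := Nat.cast_pos.2 hc
  have hs : √(total c : ℝ) ≠ 0 := (Real.sqrt_pos.2 hc').ne'
  rw [failureSum, ← score_true, score_proportions D hc, smul_smul]
  congr 1
  rw [eq_inv_mul_iff_mul_eq₀ hs, Real.mul_self_sqrt hc'.le]

lemma map_failureSum {E F : Type*} [NormedAddCommGroup E] [NormedSpace ℝ E]
    [NormedAddCommGroup F] [NormedSpace ℝ F] (L : E →L[ℝ] F) (c : Fin I → ℕ) (v : Fin I → E)
    (ω : Ω) : L (failureSum D θ₀ T c v ω) = failureSum D θ₀ T c (fun i => L (v i)) ω := by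
  simp [failureSum]

lemma norm_failureSum_le {E : Type*} [NormedAddCommGroup E] [NormedSpace ℝ E] (c : Fin I → ℕ)
    (v : Fin I → E) (ω : Ω) {R : ℝ}
    (h : ∀ i, (√(total c : ℝ))⁻¹ *
      |(failures D T c ω i : ℝ) - c i * Real.sigmoid (logit D i θ₀)| ≤ R) :
    ‖failureSum D θ₀ T c v ω‖ ≤ R * ∑ i, ‖v i‖ := by
  rw [failureSum, Finset.smul_sum, Finset.mul_sum]
  refine (norm_sum_le _ _).trans (Finset.sum_le_sum fun i _ => ?_)
  rw [norm_smul, norm_smul, ← mul_assoc, Real.norm_of_nonneg (by positivity), Real.norm_eq_abs]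
  exact mul_le_mul_of_nonneg_right (h i) (norm_nonneg _)

variable [MeasurableSpace Ω] {P : Measure Ω} {Ks : ℕ → Fin I → ℕ} {w : Fin I → ℝ}

lemma withHighProb_isRestrictedRoot_of_mle
    (hm : ContDiffAt ℝ 1 m θ₀) (hsurj : Function.Surjective (fderiv ℝ m θ₀))
    {est : ℕ → (Fin I → ℕ) → Param J}
    (hest : TendstoInMeasure P (fun N ω => est N (failures D T (Ks N) ω)) atTop (fun _ => θ₀))
    (h : WithHighProb P fun N => {ω | IsRestrictedMLE D m (Ks N) (failures D T (Ks N) ω)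
      (est N (failures D T (Ks N) ω))}) :
    WithHighProb P fun N => {ω | IsRestrictedRoot D m (Ks N) (failures D T (Ks N) ω) 0
      (est N (failures D T (Ks N) ω))} := by
  rw [tendstoInMeasure_const_iff] at hest
  refine (h.inter (hest _ (eventually_contDiffAt_surjective hm hsurj))).mono
    (Eventually.of_forall fun N ω => ?_)
  rintro ⟨h1, h2, h3⟩
  exact h1.isRestrictedLocalMLE.isRestrictedRoot (failures_le D T (Ks N) ω) h2 h3

variable [IsProbabilityMeasure P]

lemma tendstoInDistribution_failureSum (hI : (fisherInfo D w θ₀).PosDef)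
    (hM : Function.Injective (constraintMatrix m θ₀).mulVec)
    (hT : ∀ i k, Measurable (T i k)) (hTindep : iIndepFun (fun q : Fin I × ℕ => T q.1 q.2) P)
    (hTlaw : ∀ i k, IsLogLogistic P (T i k) (scale D θ₀ i) (shape D θ₀ i))
    (hK : Tendsto (fun N => total (Ks N)) atTop atTop)
    (hw : ∀ i, Tendsto (fun N => (Ks N i : ℝ) / (total (Ks N) : ℝ)) atTop (𝓝 (w i))) :
    TendstoInDistribution (fun N => failureSum D θ₀ T (Ks N)
        fun i => dualOp (asympCov D m w θ₀) (fderiv ℝ (logit D i) θ₀))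
      atTop (id : Param J → Param J) (fun _ => P)
      (multivariateGaussian 0 (asympCov D m w θ₀)) where
  forall_aemeasurable N := (measurable_failureSum hT (Ks N) _).aemeasurable
  tendsto := by
    refine ProbabilityMeasure.tendsto_iff_tendsto_charFun.2 fun t => ?_
    simp only [ProbabilityMeasure.coe_mk, Measure.map_id]
    rw [charFun_multivariateGaussian (posSemidef_asympCov hI hM),
      ← sum_inner_sq_eq hI hM t]
    simp_rw [charFun_failureSum hT hTindep hTlaw]
    have h := tendsto_finsetProd Finset.univ fun i _ =>
      tendsto_bernoulliCharFun_pow (p := Real.sigmoid (logit D i θ₀))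
        (s := inner ℝ (dualOp (asympCov D m w θ₀) (fderiv ℝ (logit D i) θ₀)) t) hK (hw i)
    convert h using 2
    rw [← Complex.exp_sum]
    congr 1
    rw [← Finset.sum_div, Finset.sum_neg_distrib]
    push_cast
    simp [neg_div]

lemma exists_consistent_root (hI : (fisherInfo D w θ₀).PosDef) (hw0 : ∀ i, 0 ≤ w i)
    (hm : ContDiffAt ℝ 1 m θ₀) (hsurj : Function.Surjective (fderiv ℝ m θ₀)) (hθ₀ : m θ₀ = 0)
    (hK : Tendsto (fun N => total (Ks N)) atTop atTop)
    (hprop : TendstoInMeasure P (fun N ω => proportions (Ks N) (failures D T (Ks N) ω)) atTop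
      fun _ => (w, meanProp (logit D) w θ₀)) :
    ∃ est : ℕ → (Fin I → ℕ) → Param J,
      Tendsto (fun N => P {ω |
          IsRestrictedRoot D m (Ks N) (failures D T (Ks N) ω) 0
            (est N (failures D T (Ks N) ω)) ∧
          IsRestrictedLocalMLE D m (Ks N) (failures D T (Ks N) ω)
            (est N (failures D T (Ks N) ω))}) atTop (𝓝 1) ∧
      TendstoInMeasure P (fun N ω => est N (failures D T (Ks N) ω)) atTop (fun _ => θ₀) := by
  have hdet := (Matrix.isUnit_iff_isUnit_det (fisherInfo D w θ₀)).1 hI.isUnit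
  obtain ⟨e, he, hmax⟩ := exists_local_maximizer (contDiff_logit D) hw0 hm hsurj hθ₀
    fun v hv => eq_zero_of_fderiv_logit D hdet hv
  rw [tendstoInMeasure_const_iff] at hprop
  refine ⟨fun N n => e (proportions (Ks N) n), ?_, ?_⟩
  · have hgood := hmax.and (he.eventually (eventually_contDiffAt_surjective hm hsurj))
    refine WithHighProb.tendsto_one (((hprop _ hgood).inter (withHighProb_total_pos hK)).mono
      (Eventually.of_forall fun N ω => ?_))
    rintro ⟨⟨⟨h1, h2⟩, h3, h4⟩, h5⟩
    have hloc := isRestrictedLocalMLE_of_isLocalMaxOn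
      (failures_le D T (Ks N) ω) h5 h1 h2
    exact ⟨hloc.isRestrictedRoot (failures_le D T (Ks N) ω) h3 h4, hloc⟩
  · rw [tendstoInMeasure_const_iff]
    exact fun U hU => hprop _ (he hU)

lemma tendstoInMeasure_root_sub_failureSum (hI : (fisherInfo D w θ₀).PosDef)
    (hm : ContDiffAt ℝ 1 m θ₀) (hsurj : Function.Surjective (fderiv ℝ m θ₀)) (hθ₀ : m θ₀ = 0)
    (hT : ∀ i k, Measurable (T i k)) (hTindep : iIndepFun (fun q : Fin I × ℕ => T q.1 q.2) P)
    (hTlaw : ∀ i k, IsLogLogistic P (T i k) (scale D θ₀ i) (shape D θ₀ i))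
    (hK : Tendsto (fun N => total (Ks N)) atTop atTop)
    (hprop : TendstoInMeasure P (fun N ω => proportions (Ks N) (failures D T (Ks N) ω)) atTop
      fun _ => (w, meanProp (logit D) w θ₀))
    {est : ℕ → (Fin I → ℕ) → Param J}
    (hest : TendstoInMeasure P (fun N ω => est N (failures D T (Ks N) ω)) atTop (fun _ => θ₀))
    (hroot : WithHighProb P fun N => {ω | IsRestrictedRoot D m (Ks N) (failures D T (Ks N) ω) 0
      (est N (failures D T (Ks N) ω))}) :
    TendstoInMeasure P ((fun N ω => √(total (Ks N) : ℝ) • (est N (failures D T (Ks N) ω) - θ₀)) -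
      fun N => failureSum D θ₀ T (Ks N)
        fun i => dualOp (asympCov D m w θ₀) (fderiv ℝ (logit D i) θ₀)) atTop 0 := by
  have hM := injective_constraintMatrix_mulVec hsurj
  obtain ⟨Q, hQ⟩ := exists_dualOp_asympCov_info m hI
  rw [tendstoInMeasure_const_iff] at hprop hest
  rw [tendstoInMeasure_iff_norm]
  intro η hη
  refine tendsto_measure_zero_of_forall_exists fun κ hκ => ?_
  obtain ⟨R, hR, hbound⟩ := exists_bound_failures (D := D) hT hTindep hTlaw hκ
  set C : ℝ := R * ∑ i, ‖fderiv ℝ (logit D i) θ₀‖ with hC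
  have hC0 : 0 ≤ C := by positivity
  set ε : ℝ := η / (C + 1) with hε
  have hε0 : 0 < ε := by positivity
  have hexp := eventually_root_expansion (contDiff_logit D) hm hsurj
    (dualOp_asympCov_comp hI hM) hQ hε0
  rw [nhds_prod_eq] at hexp
  obtain ⟨U, hU, V, hV, hUV⟩ := Filter.eventually_prod_iff.1 hexp
  refine ⟨_, ((hprop _ hU).inter (hest _ hV)).inter (hroot.inter (withHighProb_total_pos hK)),
    fun N => ?_⟩
  by_cases hN : 0 < total (Ks N)
  · refine (measure_mono ?_).trans (hbound (Ks N) hN)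
    rintro ω ⟨hω, ⟨h1, h2⟩, h3, -⟩
    by_contra hcon
    simp only [Set.mem_ofPred_eq, not_exists, not_le] at hcon hω
    refine absurd hω (not_le.2 ?_)
    have hs : 0 < √(total (Ks N) : ℝ) := Real.sqrt_pos.2 (Nat.cast_pos.2 hN)
    have h4 := hUV h1 h2 (h3.2.trans hθ₀.symm) (exists_multiplier_proportions hN h3)
    have h5 := mul_le_mul_of_nonneg_left h4 hs.le
    simp only at h5
    rw [mul_left_comm] at h5
    have h6 : ∀ {G : Type _} [NormedAddCommGroup G] [NormedSpace ℝ G] (x : G),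
        √(total (Ks N) : ℝ) * ‖x‖ = ‖√(total (Ks N) : ℝ) • x‖ := fun x => by
      rw [norm_smul, Real.norm_of_nonneg hs.le]
    rw [h6, h6, smul_sub, ← map_smul, sqrt_smul_score_proportions hN, map_failureSum] at h5
    have h7 := norm_failureSum_le (D := D) (θ₀ := θ₀) (T := T) (Ks N)
      (fun i => fderiv ℝ (logit D i) θ₀) ω fun i => (hcon i).le
    rw [← hC] at h7
    simp only [Pi.sub_apply, Pi.zero_apply, sub_zero]
    refine h5.trans_lt ((mul_le_mul_of_nonneg_left h7 hε0.le).trans_lt ?_)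
    rw [hε, div_mul_eq_mul_div, div_lt_iff₀ (by positivity)]
    exact mul_lt_mul_of_pos_left (lt_add_one C) hη
  · exact (measure_mono (t := ∅) fun ω hω => hN hω.2.2.2).trans (by simp)

end OneShot

end

theorem mainTheorem10 {I J r : ℕ} (D : OneShot.Design I J)
    -- the restriction `m(θ) = 0`, and the true parameter in the restricted space
    (m : OneShot.Param J → EuclideanSpace ℝ (Fin r)) (θ₀ : OneShot.Param J)
    (hθ₀ : θ₀ ∈ OneShot.restrictedSpace m)
    (hm : ContDiffAt ℝ 1 m θ₀)
    (hrank : (OneShot.constraintMatrix m θ₀).rank = r)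
    -- independent lifetimes, log-logistic under the true parameter
    {Ω : Type*} [MeasurableSpace Ω] (P : Measure Ω) [IsProbabilityMeasure P]
    (T : Fin I → ℕ → Ω → ℝ) (hTmeas : ∀ i k, Measurable (T i k))
    (hTindep : iIndepFun (fun p : Fin I × ℕ => T p.1 p.2) P)
    (hTlaw : ∀ i k, OneShot.IsLogLogistic P (T i k)
      (OneShot.scale D θ₀ i) (OneShot.shape D θ₀ i))
    -- the sizes of the groups in the `N`-th experiment, with `K → ∞` and `K_i / K → w_i`
    (Ks : ℕ → Fin I → ℕ) (w : Fin I → ℝ)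
    (hK : Tendsto (fun N => OneShot.total (Ks N)) atTop atTop)
    (hw : ∀ i, Tendsto (fun N => (Ks N i : ℝ) / (OneShot.total (Ks N) : ℝ)) atTop (𝓝 (w i)))
    -- the Fisher information matrix is invertible
    (hIF : IsUnit (OneShot.fisherInfo D w θ₀).det) :
    -- a consistent sequence of roots of the restricted likelihood equations exists
    (∃ est : ℕ → (Fin I → ℕ) → OneShot.Param J,
      Tendsto (fun N => P {ω |
          OneShot.IsRestrictedRoot D m (Ks N) (OneShot.failures D T (Ks N) ω) 0
            (est N (OneShot.failures D T (Ks N) ω)) ∧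
          OneShot.IsRestrictedLocalMLE D m (Ks N) (OneShot.failures D T (Ks N) ω)
            (est N (OneShot.failures D T (Ks N) ω))}) atTop (𝓝 1) ∧
      TendstoInMeasure P (fun N ω => est N (OneShot.failures D T (Ks N) ω)) atTop
        (fun _ => θ₀)) ∧
    (OneShot.asympCov D m w θ₀).PosSemidef ∧
    -- every consistent sequence of roots, or of restricted maximum likelihood estimators, is
    -- asymptotically normal
    (∀ est : ℕ → (Fin I → ℕ) → OneShot.Param J,
      (Tendsto (fun N => P {ω |
          OneShot.IsRestrictedRoot D m (Ks N) (OneShot.failures D T (Ks N) ω) 0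
            (est N (OneShot.failures D T (Ks N) ω))}) atTop (𝓝 1) ∨
        Tendsto (fun N => P {ω |
          OneShot.IsRestrictedMLE D m (Ks N) (OneShot.failures D T (Ks N) ω)
            (est N (OneShot.failures D T (Ks N) ω))}) atTop (𝓝 1)) →
      TendstoInMeasure P (fun N ω => est N (OneShot.failures D T (Ks N) ω)) atTop
        (fun _ => θ₀) →
      TendstoInDistribution
        (fun N ω => Real.sqrt (OneShot.total (Ks N) : ℝ) •
          (est N (OneShot.failures D T (Ks N) ω) - θ₀))
        atTop (id : OneShot.Param J → OneShot.Param J) (fun _ => P)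
        (multivariateGaussian 0 (OneShot.asympCov D m w θ₀))) := by
  have hw0 : ∀ i, 0 ≤ w i := fun i => ge_of_tendsto' (hw i) fun N => by positivity
  have hI : (OneShot.fisherInfo D w θ₀).PosDef :=
    (OneShot.posSemidef_fisherInfo D hw0 θ₀).posDef_iff_det_ne_zero.2 hIF.ne_zero
  have hsurj := OneShot.surjective_fderiv_of_rank hrank
  have hM := OneShot.injective_constraintMatrix_mulVec hsurj
  have hprop := OneShot.tendstoInMeasure_proportions hTmeas hTindep hTlaw hK hw
  refine ⟨OneShot.exists_consistent_root hI hw0 hm hsurj hθ₀ hK hprop,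
    OneShot.posSemidef_asympCov hI hM, fun est hest hcons => ?_⟩
  have hmeas : ∀ N (Q : (Fin I → ℕ) → Prop),
      MeasurableSet {ω | Q (OneShot.failures D T (Ks N) ω)} := fun N Q =>
    OneShot.measurable_failures hTmeas (Ks N) (MeasurableSet.of_discrete (s := {n | Q n}))
  have hroot : WithHighProb P fun N => {ω | OneShot.IsRestrictedRoot D m (Ks N)
      (OneShot.failures D T (Ks N) ω) 0 (est N (OneShot.failures D T (Ks N) ω))} := by
    rcases hest with h | h
    · exact withHighProb_of_tendsto_one (fun N => hmeas N fun n =>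
        OneShot.IsRestrictedRoot D m (Ks N) n 0 (est N n)) h
    · exact OneShot.withHighProb_isRestrictedRoot_of_mle hm hsurj hcons
        (withHighProb_of_tendsto_one (fun N => hmeas N fun n =>
          OneShot.IsRestrictedMLE D m (Ks N) n (est N n)) h)
  refine tendstoInDistribution_of_tendstoInMeasure_sub _ _
    (OneShot.tendstoInDistribution_failureSum hI hM hTmeas hTindep hTlaw hK hw)
    (OneShot.tendstoInMeasure_root_sub_failureSum hI hm hsurj hθ₀ hTmeas hTindep hTlaw hK hprop
      hcons hroot) fun N => ?_
  have h : Measurable fun n : Fin I → ℕ =>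
      √(OneShot.total (Ks N) : ℝ) • (est N n - θ₀) := measurable_of_countable _
  exact (h.comp (OneShot.measurable_failures hTmeas (Ks N))).aemeasurable
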